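/- Let $N\ge 0$ and $D\ge 1$ be integers, let $P,\sigma>0$, and put $\mathrm{SNR}=P/\sigma^2$. Let $\boldsymbol X$ be a random $N\times D$ real matrix with i.i.d. $\mathcal N(0,1)$ entries and let $\boldsymbol\varepsilon\sim\mathcal N(\boldsymbol 0,\sigma^2 I_N)$. Consider the linear system $\boldsymbol y=\boldsymbol X\boldsymbol\beta+\boldsymbol\varepsilon$, where the input $\boldsymbol\beta$ is a random vector in $\mathbb R^D$ and $\boldsymbol\beta,\boldsymbol X,\boldsymbol\varepsilon$ are independent. The mutual information $\mathcal I(U;V)$ of two random variables is the Kullback--Leibler divergence (in nats) of their joint law from the product of their marginal laws. The channel capacity of the system under the power constraint $P$ is $$\mathcal C=\sup\bigl\{\mathcal I(\boldsymbol\beta;(\boldsymbol y,\boldsymbol X)) \;:\; \mathbb E[\boldsymbol\beta^{\intercal}\boldsymbol\beta]\le P\bigr\},$$ the supremum being over all laws of $\boldsymbol\beta$ on $\mathbb R^D$ with $\mathbb E[\boldsymbol\beta^{\intercal}\boldsymbol\beta]\le P$. A maximum entropy prior is a law with $\mathbb E[\boldsymbol\beta^{\intercal}\boldsymbol\beta]\le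 P$ whose differential entropy is the largest among all such laws. **Theorem (Channel Capacity).** There is exactly one maximum entropy prior, namely $\mathcal N(\boldsymbol 0,\tfrac PD I_D)$. The random variable $\log\det\bigl(I_N+\frac{\mathrm{SNR}}{D}\boldsymbol X\boldsymbol X^{\intercal}\bigr)$ is integrable, and $$\mathcal C=\frac12\,\mathbb E\left[\log\det\left(I_N+\frac{\mathrm{SNR}}{D}\boldsymbol X\boldsymbol X^{\intercal}\right)\right].$$ Moreover, the maximum entropy prior attains the capacity: if $\boldsymbol\beta$ has this law, then $\mathcal I(\boldsymbol\beta;(\boldsymbol y,\boldsymbol X))=\mathcal C$. -/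

import Mathlib

open MeasureTheory ProbabilityTheory InformationTheory Matrix
open scoped ENNReal

noncomputable section

/-- Mutual information `I(U; V)` (in nats) of two random variables on `(Ω, Pr)`: the
Kullback-Leibler divergence of their joint law from the product of their marginal laws. -/
def mutualInfo {Ω A B : Type*} [MeasurableSpace Ω] [MeasurableSpace A] [MeasurableSpace B]
    (Pr : Measure Ω) (U : Ω → A) (V : Ω → B) : ℝ≥0∞ :=
  klDiv (Pr.map (fun ω => (U ω, V ω))) ((Pr.map U).prod (Pr.map V))

/-- The isotropic centred Gaussian law `N(0, v I_n)` on `ℝⁿ`: the `n` coordinates are independent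
and each of them has law `N(0, v)`. (Meant for `v ≥ 0`.) -/
def isoGaussian (n : ℕ) (v : ℝ) : Measure (Fin n → ℝ) :=
  Measure.pi (fun _ => gaussianReal 0 v.toNNReal)

/-- The Borel (product) sigma-algebra on real matrices: matrices are functions of two indices. -/
instance instMeasurableSpaceRealMatrix (m n : Type*) : MeasurableSpace (Matrix m n ℝ) :=
  inferInstanceAs (MeasurableSpace (m → n → ℝ))

/-- The law of a random `N × D` real matrix whose entries are i.i.d. `N(0, 1)`. -/
def gaussianMatrix (N D : ℕ) : Measure (Matrix (Fin N) (Fin D) ℝ) :=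
  Measure.pi (fun _ : Fin N => Measure.pi (fun _ : Fin D => gaussianReal 0 1))

/-- `μ` is a probability law on `ℝᴰ` that obeys the power constraint `E[βᵀ β] ≤ P`. -/
def PowerConstrained {D : ℕ} (P : ℝ) (μ : Measure (Fin D → ℝ)) : Prop :=
  IsProbabilityMeasure μ ∧ ∫⁻ b, ENNReal.ofReal (b ⬝ᵥ b) ∂μ ≤ ENNReal.ofReal P

open scoped Classical in
/-- Differential entropy `h(μ) = -∫ p log p` (in nats), an extended real number, of a probability
law `μ` on `ℝᴰ` with Lebesgue density `p`: the `μ`-integral of the positive part of `-log p` minus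
that of the negative part. It is `-∞` if `μ` has no density. (If both integrals are infinite, the
entropy does not exist and the value is `-∞`; this never happens for a law with a finite second
moment, where the first integral is finite.) -/
def differentialEntropy {D : ℕ} (μ : Measure (Fin D → ℝ)) : EReal :=
  if μ ≪ volume then
    ((∫⁻ b, ENNReal.ofReal (-Real.log (μ.rnDeriv volume b).toReal) ∂μ : ℝ≥0∞) : EReal)
      - ((∫⁻ b, ENNReal.ofReal (Real.log (μ.rnDeriv volume b).toReal) ∂μ : ℝ≥0∞) : EReal)
  else ⊥

/-- `μ` is a maximum entropy law on `ℝᴰ` under the power constraint `E[βᵀ β] ≤ P`. -/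
def IsMaxEntropyPrior {D : ℕ} (P : ℝ) (μ : Measure (Fin D → ℝ)) : Prop :=
  PowerConstrained P μ ∧
    ∀ ν : Measure (Fin D → ℝ), PowerConstrained P ν →
      differentialEntropy ν ≤ differentialEntropy μ

/-- The output `y = X β + ε` of the linear system. -/
def linearOutput {N D : ℕ} (X : Matrix (Fin N) (Fin D) ℝ) (b : Fin D → ℝ) (e : Fin N → ℝ) :
    Fin N → ℝ :=
  X *ᵥ b + e

/-- The information `I(β; (y, X))` that the pair `(y, X)` carries about an input `β` of law `μ`,
where `y = X β + ε`, the entries of `X` are i.i.d. `N(0, 1)`, `ε` has law `N(0, σ² I_N)`, and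
`β`, `X`, `ε` are independent. They are realised as the coordinates of a product space. -/
def inputInformation (N D : ℕ) (σ : ℝ) (μ : Measure (Fin D → ℝ)) : ℝ≥0∞ :=
  mutualInfo (μ.prod ((gaussianMatrix N D).prod (isoGaussian N (σ ^ 2))))
    (fun ω => ω.1)
    (fun ω => (linearOutput ω.2.1 ω.1 ω.2.2, ω.2.1))

/-- The channel capacity of `y = X β + ε` with `X` known to the receiver: the supremum of
`I(β; (y, X))` over all input laws that obey the power constraint `E[βᵀ β] ≤ P`. -/
def channelCapacity (N D : ℕ) (P σ : ℝ) : ℝ≥0∞ :=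
  ⨆ (μ : Measure (Fin D → ℝ)) (_ : PowerConstrained P μ), inputInformation N D σ μ

end

/-! The capacity formula rests on comparing each output law with one fixed Gaussian reference. Put
`s = σ²`, `c = SNR / D`, `A = I + c X Xᵀ`. Let `f` be the transition density of `y` given `(β, X)`,
`p` the density of `y` given `X`, and `q` the density of `N(0, s A)`, which is `p` when `β` has law
`N(0, (P/D) I)`. The information is `E log f - E log p`. Gibbs' inequality gives `E log q ≤ E log p`
under the true output law, so the information is at most `E log (f / q)`, with equality for the
Gaussian input.

This bound is explicit: it equals `½ E log det A + (E|β|² / D - s c) · E tr G / (2 s)` with `G = Xᵀ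
A⁻¹ X` (`integral_log_channelDensity_sub`). The input law enters only through `E|β|²`, because the
law of `X` is invariant under sign changes and permutations of columns, which makes `E G` a multiple
of the identity (`integral_dotProduct_gainMatrix`). Since `s c = P / D` and `tr G ≥ 0`, the
correction is nonpositive under the power constraint, and it vanishes for the Gaussian input. The
argument needs neither a density of `β` nor concavity of `log det`.

The maximum entropy claim is Gibbs' inequality on `ℝᴰ`: entropy is at most the cross entropy with
`N(0, (P/D) I)`, which is affine and increasing in the second moment. The equality case of the
Kullback-Leibler divergence gives uniqueness. -/

/-- The Lebesgue density of `isoGaussian n v`. -/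
noncomputable def gaussDensity (n : ℕ) (v : ℝ) (x : Fin n → ℝ) : ℝ :=
  (√(2 * Real.pi * v))⁻¹ ^ n * Real.exp (-(x ⬝ᵥ x) / (2 * v))

lemma gaussDensity_pos (n : ℕ) {v : ℝ} (hv : 0 < v) (x : Fin n → ℝ) : 0 < gaussDensity n v x := by
  have := Real.pi_pos
  unfold gaussDensity
  positivity

lemma continuous_gaussDensity (n : ℕ) (v : ℝ) : Continuous (gaussDensity n v) := by
  unfold gaussDensity dotProduct
  fun_prop

@[fun_prop]
lemma measurable_gaussDensity (n : ℕ) (v : ℝ) : Measurable (gaussDensity n v) :=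
  (continuous_gaussDensity n v).measurable

lemma gaussDensity_le (n : ℕ) {v : ℝ} (hv : 0 < v) (x : Fin n → ℝ) :
    gaussDensity n v x ≤ (√(2 * Real.pi * v))⁻¹ ^ n := by
  have := Real.pi_pos
  unfold gaussDensity
  refine mul_le_of_le_one_right (by positivity) (Real.exp_le_one_iff.2 ?_)
  refine div_nonpos_of_nonpos_of_nonneg ?_ (by positivity)
  simpa using dotProduct_self_star_nonneg x

lemma log_gaussDensity (n : ℕ) {v : ℝ} (hv : 0 < v) (x : Fin n → ℝ) :
    Real.log (gaussDensity n v x)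
      = -(n * Real.log (√(2 * Real.pi * v))) - (x ⬝ᵥ x) / (2 * v) := by
  have := Real.pi_pos
  unfold gaussDensity
  rw [Real.log_mul (by positivity) (by positivity), Real.log_exp, Real.log_pow, Real.log_inv]
  ring

lemma gaussDensity_eq_prod (n : ℕ) {v : ℝ} (hv : 0 < v) (x : Fin n → ℝ) :
    gaussDensity n v x = ∏ i, gaussianPDFReal 0 v.toNNReal (x i) := by
  simp only [gaussianPDFReal, Finset.prod_mul_distrib, ← Real.exp_sum, gaussDensity,
    Real.coe_toNNReal v hv.le, Finset.prod_const, Finset.card_univ, Fintype.card_fin, sub_zero,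
    dotProduct, ← Finset.sum_div, Finset.sum_neg_distrib, pow_two]

lemma isoGaussian_eq_withDensity (n : ℕ) {v : ℝ} (hv : 0 < v) :
    isoGaussian n v = volume.withDensity (fun x => ENNReal.ofReal (gaussDensity n v x)) := by
  have hv' : v.toNNReal ≠ 0 := by simpa using hv
  refine Measure.pi_eq fun s hs => ?_
  have key (i : Fin n) : gaussianReal 0 v.toNNReal (s i)
      = ENNReal.ofReal (∫ x in s i, gaussianPDFReal 0 v.toNNReal x) :=
    gaussianReal_apply_eq_integral 0 hv' _
  simp_rw [key]
  rw [withDensity_apply _ (MeasurableSet.univ_pi hs),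
    ← ENNReal.ofReal_prod_of_nonneg
      (fun i _ => integral_nonneg fun x => gaussianPDFReal_nonneg _ _ x),
    ← integral_fintype_prod_eq_prod, volume_pi, Measure.restrict_pi_pi]
  simp_rw [gaussDensity_eq_prod n hv]
  rw [ofReal_integral_eq_lintegral_ofReal]
  · refine Integrable.fintype_prod fun i => (integrable_gaussianPDFReal _ _).integrableOn
  · exact ae_of_all _ fun x => Finset.prod_nonneg fun i _ => gaussianPDFReal_nonneg _ _ _

instance (n : ℕ) (v : ℝ) : IsProbabilityMeasure (isoGaussian n v) := by
  unfold isoGaussian; infer_instance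

instance (N D : ℕ) : IsProbabilityMeasure (gaussianMatrix N D) := by
  unfold gaussianMatrix
  exact (inferInstance : IsProbabilityMeasure
    (Measure.pi fun _ : Fin N => Measure.pi fun _ : Fin D => gaussianReal 0 1))

/-! ### Kullback-Leibler divergence and Gibbs' inequality for densities -/

section KL

variable {α : Type*} [MeasurableSpace α] {m : Measure α} {f g : α → ℝ}

lemma withDensity_ofReal_eq_withDensity_div (hf : Measurable f) (hg : Measurable g)
    (hgpos : ∀ x, 0 < g x) :
    m.withDensity (fun x => ENNReal.ofReal (f x))
      = (m.withDensity (fun x => ENNReal.ofReal (g x))).withDensity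
        (fun x => ENNReal.ofReal (f x / g x)) := by
  rw [← withDensity_mul _ (by fun_prop) (by fun_prop)]
  congr 1
  ext x
  rw [Pi.mul_apply, ← ENNReal.ofReal_mul (hgpos x).le, mul_div_cancel₀ _ (hgpos x).ne']

/-- The Kullback-Leibler divergence of two probability measures with positive densities. -/
lemma klDiv_withDensity_withDensity [SigmaFinite m] (hf : Measurable f) (hg : Measurable g)
    (hfpos : ∀ x, 0 < f x) (hgpos : ∀ x, 0 < g x) {μ ν : Measure α}
    [IsProbabilityMeasure μ] [IsProbabilityMeasure ν]
    (hμ : μ = m.withDensity (fun x => ENNReal.ofReal (f x)))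
    (hν : ν = m.withDensity (fun x => ENNReal.ofReal (g x)))
    (hint : Integrable (fun x => Real.log (f x) - Real.log (g x)) μ) :
    klDiv μ ν = ENNReal.ofReal (∫ x, (Real.log (f x) - Real.log (g x)) ∂μ) := by
  have h1 : μ = ν.withDensity (fun x => ENNReal.ofReal (f x / g x)) := by
    rw [hμ, hν, withDensity_ofReal_eq_withDensity_div hf hg hgpos]
  have hac : μ ≪ ν := h1 ▸ withDensity_absolutelyContinuous _ _
  have hd : μ.rnDeriv ν =ᵐ[ν] fun x => ENNReal.ofReal (f x / g x) := by
    conv_lhs => rw [h1]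
    exact Measure.rnDeriv_withDensity _ (by fun_prop)
  have hl : llr μ ν =ᵐ[μ] fun x => Real.log (f x) - Real.log (g x) := by
    filter_upwards [hac.ae_le hd] with x hx
    rw [llr, hx, ENNReal.toReal_ofReal (div_nonneg (hfpos x).le (hgpos x).le),
      Real.log_div (hfpos x).ne' (hgpos x).ne']
  rw [klDiv_of_ac_of_integrable hac (hint.congr hl.symm), integral_congr_ae hl]
  simp

/-- Gibbs' inequality for positive densities, the first of which is bounded. -/
lemma integrable_log_and_integral_log_le (hf : Measurable f) (hg : Measurable g)
    (hfpos : ∀ x, 0 < f x) (hgpos : ∀ x, 0 < g x) {μ ν : Measure α}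
    [IsProbabilityMeasure μ] [IsProbabilityMeasure ν]
    (hμ : μ = m.withDensity (fun x => ENNReal.ofReal (f x)))
    (hν : ν = m.withDensity (fun x => ENNReal.ofReal (g x)))
    {C : ℝ} (hC : ∀ x, f x ≤ C) (hint : Integrable (fun x => Real.log (g x)) μ) :
    Integrable (fun x => Real.log (f x)) μ ∧
      ∫ x, Real.log (g x) ∂μ ≤ ∫ x, Real.log (f x) ∂μ := by
  have h1 : ν = μ.withDensity (fun x => ENNReal.ofReal (g x / f x)) := by
    rw [hμ, hν, withDensity_ofReal_eq_withDensity_div hg hf hfpos]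
  have hl : ∫⁻ x, ENNReal.ofReal (g x / f x) ∂μ = 1 := by
    rw [← setLIntegral_univ, ← withDensity_apply _ MeasurableSet.univ, ← h1, measure_univ]
  have hnn : 0 ≤ᵐ[μ] fun x => g x / f x :=
    ae_of_all _ fun x => div_nonneg (hgpos x).le (hfpos x).le
  have hri : Integrable (fun x => g x / f x) μ := by
    refine ⟨(hg.div hf).aestronglyMeasurable, ?_⟩
    rw [hasFiniteIntegral_iff_ofReal hnn, hl]
    exact ENNReal.one_lt_top
  have hr1 : ∫ x, g x / f x ∂μ = 1 := by
    rw [integral_eq_lintegral_of_nonneg_ae hnn (hg.div hf).aestronglyMeasurable, hl]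
    simp
  -- The elementary bound `log t ≤ t - 1` at `t = g / f`. It bounds `log f` below by an integrable
  -- function, and the constant `log C` bounds it above. Integrated, it is Gibbs' inequality, since
  -- `g / f` has `μ`-integral 1.
  have hle (x : α) : Real.log (g x) - (g x / f x - 1) ≤ Real.log (f x) := by
    have := Real.log_le_sub_one_of_pos (div_pos (hgpos x) (hfpos x))
    rw [Real.log_div (hgpos x).ne' (hfpos x).ne'] at this
    linarith
  have hi2 : Integrable (fun x => Real.log (g x) - (g x / f x - 1)) μ :=
    hint.sub (hri.sub (integrable_const 1))
  have hfi : Integrable (fun x => Real.log (f x)) μ :=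
    integrable_of_le_of_le (hf.log.aestronglyMeasurable)
      (ae_of_all _ hle) (ae_of_all _ fun x => Real.log_le_log (hfpos x) (hC x))
      hi2 (integrable_const (Real.log C))
  refine ⟨hfi, ?_⟩
  have h2 : ∫ x, (g x / f x - 1) ∂μ = 0 := by
    rw [integral_sub hri (integrable_const 1), hr1]
    simp
  have h3 := integral_mono hi2 hfi hle
  rwa [integral_sub (g := fun x => g x / f x - 1) hint (hri.sub (integrable_const 1)), h2,
    sub_zero] at h3

end KL

/-! ### Linear algebra of `I + c X Xᵀ` -/

section Mat

lemma dotProduct_self_nonneg' {m : Type*} [Fintype m] (u : m → ℝ) : 0 ≤ u ⬝ᵥ u := by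
  simpa using dotProduct_self_star_nonneg u

lemma mulVec_dotProduct_eq {m n : Type*} [Fintype m] [Fintype n] (X : Matrix m n ℝ) (u : m → ℝ)
    (b : n → ℝ) : (X *ᵥ b) ⬝ᵥ u = b ⬝ᵥ (Xᵀ *ᵥ u) := by
  rw [dotProduct_comm, dotProduct_mulVec, dotProduct_comm, mulVec_transpose]

variable {m n : Type*} [Fintype m] [Fintype n] [DecidableEq m]
  {c : ℝ} (X : Matrix m n ℝ)

lemma posDef_one_add_smul_mul_transpose (hc : 0 ≤ c) : (1 + c • (X * Xᵀ)).PosDef := by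
  refine PosDef.add_posSemidef PosDef.one ?_
  have := posSemidef_self_mul_conjTranspose X
  rw [conjTranspose_eq_transpose_of_trivial] at this
  exact this.smul hc

lemma isUnit_det_one_add_smul (hc : 0 ≤ c) : IsUnit (1 + c • (X * Xᵀ)).det :=
  (posDef_one_add_smul_mul_transpose X hc).det_pos.ne'.isUnit

/-- The vector `w = A⁻¹ u` satisfies `u = w + c X Xᵀ w`, where `A = 1 + c X Xᵀ`. -/
lemma eq_inv_mulVec_add (hc : 0 ≤ c) (u : m → ℝ) :
    u = (1 + c • (X * Xᵀ))⁻¹ *ᵥ u + c • (X *ᵥ (Xᵀ *ᵥ ((1 + c • (X * Xᵀ))⁻¹ *ᵥ u))) := by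
  have h : (1 + c • (X * Xᵀ)) *ᵥ ((1 + c • (X * Xᵀ))⁻¹ *ᵥ u) = u := by
    rw [mulVec_mulVec, mul_nonsing_inv _ (isUnit_det_one_add_smul X hc), one_mulVec]
  conv_lhs => rw [← h]
  rw [add_mulVec, one_mulVec, smul_mulVec, ← mulVec_mulVec]

lemma dotProduct_inv_mulVec_nonneg (hc : 0 ≤ c) (u : m → ℝ) :
    0 ≤ u ⬝ᵥ (1 + c • (X * Xᵀ))⁻¹ *ᵥ u := by
  simpa using (posDef_one_add_smul_mul_transpose X hc).inv.posSemidef.dotProduct_mulVec_nonneg u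

/-- With `w = A⁻¹ u` and `u = w + c X Xᵀ w`, the difference of the two sides is `c |Xᵀ w|² + c² |X
Xᵀ w|²`. This bound removes the inverse from every integrability estimate. -/
lemma dotProduct_inv_mulVec_le (hc : 0 ≤ c) (u : m → ℝ) :
    u ⬝ᵥ (1 + c • (X * Xᵀ))⁻¹ *ᵥ u ≤ u ⬝ᵥ u := by
  have h := eq_inv_mulVec_add X hc u
  set w := (1 + c • (X * Xᵀ))⁻¹ *ᵥ u
  have h1 : u ⬝ᵥ u - u ⬝ᵥ w
      = c * ((Xᵀ *ᵥ w) ⬝ᵥ (Xᵀ *ᵥ w)) + c ^ 2 * ((X *ᵥ (Xᵀ *ᵥ w)) ⬝ᵥ (X *ᵥ (Xᵀ *ᵥ w))) := by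
    rw [← dotProduct_sub]
    have : u - w = c • (X *ᵥ (Xᵀ *ᵥ w)) := by rw [sub_eq_iff_eq_add']; exact h
    rw [this]
    nth_rewrite 1 [h]
    rw [add_dotProduct, dotProduct_smul, dotProduct_smul, smul_dotProduct,
      dotProduct_comm w, mulVec_dotProduct_eq]
    simp only [smul_eq_mul]
    ring
  have h2 : 0 ≤ u ⬝ᵥ u - u ⬝ᵥ w := by
    rw [h1]
    exact add_nonneg (mul_nonneg hc (dotProduct_self_nonneg' _))
      (mul_nonneg (by positivity) (dotProduct_self_nonneg' _))
  linarith

/-- Sum `log t ≤ t - 1` over the eigenvalues. -/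
lemma log_det_le_trace_sub {A : Matrix m m ℝ} (hA : A.PosDef) :
    Real.log A.det ≤ A.trace - Fintype.card m := by
  have h1 := hA.1.det_eq_prod_eigenvalues
  have h2 := hA.1.trace_eq_sum_eigenvalues
  simp only [RCLike.ofReal_real_eq_id, id] at h1 h2
  rw [h1, h2, Real.log_prod fun i _ => (hA.eigenvalues_pos i).ne']
  have := Finset.sum_le_sum fun i (_ : i ∈ Finset.univ) =>
    Real.log_le_sub_one_of_pos (hA.eigenvalues_pos i)
  simpa using this

lemma trace_inv_le (hc : 0 ≤ c) : ((1 + c • (X * Xᵀ))⁻¹).trace ≤ (Fintype.card m : ℝ) := by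
  have (i : m) : ((1 + c • (X * Xᵀ))⁻¹ : Matrix m m ℝ) i i ≤ 1 := by
    simpa using dotProduct_inv_mulVec_le X hc (Pi.single i 1)
  simpa [trace] using Finset.sum_le_sum fun i (_ : i ∈ Finset.univ) => this i

/-- The trace bound applied to `A⁻¹` reads `-log det A ≤ tr A⁻¹ - m`, and every diagonal entry of
`A⁻¹` is at most 1. -/
lemma log_det_nonneg (hc : 0 ≤ c) : 0 ≤ Real.log (1 + c • (X * Xᵀ)).det := by
  have h := log_det_le_trace_sub (posDef_one_add_smul_mul_transpose X hc).inv
  rw [det_nonsing_inv, Ring.inverse_eq_inv', Real.log_inv] at h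
  linarith [trace_inv_le X hc]

lemma log_det_le (hc : 0 ≤ c) :
    Real.log (1 + c • (X * Xᵀ)).det ≤ c * ∑ i, ∑ j, X i j ^ 2 := by
  have h := log_det_le_trace_sub (posDef_one_add_smul_mul_transpose X hc)
  have : (1 + c • (X * Xᵀ)).trace = Fintype.card m + c * ∑ i, ∑ j, X i j ^ 2 := by
    simp [trace, mul_apply, pow_two, Finset.mul_sum, Finset.sum_add_distrib]
  linarith

/-- Trace of `A A⁻¹ = I`, rearranged cyclically. It expresses the noise contribution `tr A⁻¹`
through the same trace `tr (Xᵀ A⁻¹ X)` that measures the signal. -/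
lemma trace_inv_add (hc : 0 ≤ c) :
    ((1 + c • (X * Xᵀ))⁻¹).trace + c * (Xᵀ * (1 + c • (X * Xᵀ))⁻¹ * X).trace
      = Fintype.card m := by
  have h := congrArg trace (mul_nonsing_inv _ (isUnit_det_one_add_smul X hc))
  rw [Matrix.add_mul, Matrix.one_mul, smul_mul, trace_add, trace_smul, trace_one,
    smul_eq_mul, Matrix.mul_assoc] at h
  rwa [Matrix.mul_assoc, trace_mul_comm Xᵀ, Matrix.mul_assoc, trace_mul_comm _ (X * Xᵀ),
    Matrix.mul_assoc]

lemma inv_transpose_eq : ((1 + c • (X * Xᵀ))⁻¹)ᵀ = (1 + c • (X * Xᵀ))⁻¹ := by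
  rw [transpose_nonsing_inv]
  simp [transpose_mul]

/-- For `c = v / s` the centre `c Xᵀ A⁻¹ y` is the posterior mean of a Gaussian input given `(y,
X)`. Around it the joint exponent splits into a part in `d` and a part in `y`, so the input can be
integrated out. -/
lemma complete_square [DecidableEq n] (hc : 0 ≤ c) (y : m → ℝ) (d : n → ℝ) :
    let w := (1 + c • (X * Xᵀ))⁻¹ *ᵥ y
    let b := c • (Xᵀ *ᵥ w) + d
    c * ((y - X *ᵥ b) ⬝ᵥ (y - X *ᵥ b)) + b ⬝ᵥ b
      = d ⬝ᵥ (1 + c • (Xᵀ * X)) *ᵥ d + c * (y ⬝ᵥ w) := by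
  intro w b
  have h : y = w + c • (X *ᵥ (Xᵀ *ᵥ w)) := eq_inv_mulVec_add X hc y
  have h1 : y - X *ᵥ b = w - X *ᵥ d := by
    nth_rewrite 1 [h]
    simp only [b, mulVec_add, mulVec_smul]
    abel
  have h2 : y ⬝ᵥ w = w ⬝ᵥ w + c * ((Xᵀ *ᵥ w) ⬝ᵥ (Xᵀ *ᵥ w)) := by
    nth_rewrite 1 [h]
    rw [add_dotProduct, smul_dotProduct, mulVec_dotProduct_eq X w, smul_eq_mul]
  have h3 : d ⬝ᵥ (1 + c • (Xᵀ * X)) *ᵥ d = d ⬝ᵥ d + c * ((X *ᵥ d) ⬝ᵥ (X *ᵥ d)) := by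
    rw [add_mulVec, one_mulVec, smul_mulVec, ← mulVec_mulVec, dotProduct_add, dotProduct_smul,
      ← mulVec_dotProduct_eq, smul_eq_mul]
  rw [h1, h2, h3]
  simp only [b, sub_dotProduct, dotProduct_sub, add_dotProduct, dotProduct_add, smul_dotProduct,
    dotProduct_smul, smul_eq_mul, mulVec_dotProduct_eq X w d, dotProduct_comm w (X *ᵥ d),
    dotProduct_comm (Xᵀ *ᵥ w) d]
  ring

end Mat

/-! ### The output density for a Gaussian input -/

/-- The Lebesgue density of `N(0, s (I + c X Xᵀ))`. -/
noncomputable def outputDensity {N D : ℕ} (s c : ℝ) (X : Matrix (Fin N) (Fin D) ℝ)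
    (y : Fin N → ℝ) : ℝ :=
  (√(2 * Real.pi * s))⁻¹ ^ N * (√(1 + c • (X * Xᵀ)).det)⁻¹ *
    Real.exp (-(y ⬝ᵥ (1 + c • (X * Xᵀ))⁻¹ *ᵥ y) / (2 * s))

lemma outputDensity_pos {N D : ℕ} {s c : ℝ} (hs : 0 < s) (hc : 0 ≤ c)
    (X : Matrix (Fin N) (Fin D) ℝ) (y : Fin N → ℝ) : 0 < outputDensity s c X y := by
  have := Real.pi_pos
  have := (posDef_one_add_smul_mul_transpose X hc).det_pos
  unfold outputDensity
  positivity

lemma log_outputDensity {N D : ℕ} {s c : ℝ} (hs : 0 < s) (hc : 0 ≤ c)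
    (X : Matrix (Fin N) (Fin D) ℝ) (y : Fin N → ℝ) :
    Real.log (outputDensity s c X y) = -(N * Real.log (√(2 * Real.pi * s)))
      - Real.log (1 + c • (X * Xᵀ)).det / 2 - (y ⬝ᵥ (1 + c • (X * Xᵀ))⁻¹ *ᵥ y) / (2 * s) := by
  have := Real.pi_pos
  have hd := (posDef_one_add_smul_mul_transpose X hc).det_pos
  unfold outputDensity
  rw [Real.log_mul (by positivity) (by positivity), Real.log_mul (by positivity) (by positivity),
    Real.log_exp, Real.log_pow, Real.log_inv, Real.log_inv, Real.log_sqrt hd.le]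
  ring

lemma lintegral_gaussDensity (n : ℕ) {v : ℝ} (hv : 0 < v) :
    ∫⁻ x, ENNReal.ofReal (gaussDensity n v x) = 1 := by
  rw [← setLIntegral_univ, ← withDensity_apply _ MeasurableSet.univ,
    ← isoGaussian_eq_withDensity n hv, measure_univ]

open scoped MatrixOrder in
-- Factor `K = Sᵀ S` and substitute `x = S d`; the Jacobian is `|det S| = √(det K)`.
lemma lintegral_exp_quadratic (n : ℕ) {v : ℝ} (hv : 0 < v) {K : Matrix (Fin n) (Fin n) ℝ}
    (hK : K.PosDef) :
    ∫⁻ d : Fin n → ℝ, ENNReal.ofReal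
      ((√(2 * Real.pi * v))⁻¹ ^ n * Real.exp (-(d ⬝ᵥ K *ᵥ d) / (2 * v)))
      = ENNReal.ofReal (√K.det)⁻¹ := by
  obtain ⟨S, hS⟩ := CStarAlgebra.nonneg_iff_eq_star_mul_self.mp hK.posSemidef.nonneg
  rw [star_eq_conjTranspose, conjTranspose_eq_transpose_of_trivial] at hS
  have hdet : K.det = S.det ^ 2 := by rw [hS, det_mul, det_transpose, pow_two]
  have hSdet : S.det ≠ 0 := fun h => hK.det_pos.ne' (by rw [hdet, h]; simp)
  have h1 (d : Fin n → ℝ) :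
      (√(2 * Real.pi * v))⁻¹ ^ n * Real.exp (-(d ⬝ᵥ K *ᵥ d) / (2 * v))
        = gaussDensity n v (toLin' S d) := by
    rw [gaussDensity, toLin'_apply, mulVec_dotProduct_eq, mulVec_mulVec, hS]
  simp_rw [h1]
  have hm : Measurable (toLin' S) :=
    (LinearMap.continuous_of_finiteDimensional (toLin' S)).measurable
  rw [← lintegral_map (f := fun x => ENNReal.ofReal (gaussDensity n v x)) (by fun_prop) hm,
    Real.map_matrix_volume_pi_eq_smul_volume_pi hSdet, lintegral_smul_measure,
    lintegral_gaussDensity n hv, smul_eq_mul, mul_one, hdet, Real.sqrt_sq_eq_abs, abs_inv]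

/-- The density of the output when the input is isotropic Gaussian. -/
lemma lintegral_gaussDensity_sub_mulVec {N D : ℕ} {s v : ℝ} (hs : 0 < s) (hv : 0 < v)
    (X : Matrix (Fin N) (Fin D) ℝ) (y : Fin N → ℝ) :
    ∫⁻ b, ENNReal.ofReal (gaussDensity N s (y - X *ᵥ b)) ∂(isoGaussian D v)
      = ENNReal.ofReal (outputDensity s (v / s) X y) := by
  have hc : 0 ≤ v / s := by positivity
  have hpi := Real.pi_pos
  have hcts : Measurable fun b => gaussDensity N s (y - X *ᵥ b) := by
    refine (measurable_gaussDensity N s).comp (Continuous.measurable ?_)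
    fun_prop
  -- Translation invariance moves the origin of the input to the posterior mean, where
  -- `complete_square` applies.
  rw [isoGaussian_eq_withDensity D hv, lintegral_withDensity_eq_lintegral_mul _ (by fun_prop)
    (by fun_prop), ← lintegral_add_left_eq_self _
      ((v / s) • (Xᵀ *ᵥ ((1 + (v / s) • (X * Xᵀ))⁻¹ *ᵥ y)))]
  have hK : (1 + (v / s) • (Xᵀ * X)).PosDef := by
    simpa using posDef_one_add_smul_mul_transpose Xᵀ hc
  -- Sylvester's identity: the Gaussian integral produces the `D × D` determinant, while the output
  -- density carries the `N × N` one.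
  have hdet : (1 + (v / s) • (Xᵀ * X)).det = (1 + (v / s) • (X * Xᵀ)).det := by
    rw [← smul_mul, det_one_add_mul_comm, Matrix.mul_smul]
  have key (d : Fin D → ℝ) :
      ((fun x => ENNReal.ofReal (gaussDensity D v x)) *
        fun b => ENNReal.ofReal (gaussDensity N s (y - X *ᵥ b)))
        ((v / s) • (Xᵀ *ᵥ ((1 + (v / s) • (X * Xᵀ))⁻¹ *ᵥ y)) + d)
      = ENNReal.ofReal ((√(2 * Real.pi * s))⁻¹ ^ N *
          Real.exp (-(y ⬝ᵥ (1 + (v / s) • (X * Xᵀ))⁻¹ *ᵥ y) / (2 * s))) *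
        ENNReal.ofReal ((√(2 * Real.pi * v))⁻¹ ^ D *
          Real.exp (-(d ⬝ᵥ (1 + (v / s) • (Xᵀ * X)) *ᵥ d) / (2 * v))) := by
    have hsq := complete_square X hc y d
    simp only at hsq
    rw [Pi.mul_apply, ← ENNReal.ofReal_mul (gaussDensity_pos D hv _).le,
      ← ENNReal.ofReal_mul (by positivity)]
    congr 1
    unfold gaussDensity
    rw [mul_mul_mul_comm, mul_mul_mul_comm ((√(2 * Real.pi * s))⁻¹ ^ N), ← Real.exp_add,
      ← Real.exp_add]
    rw [mul_comm ((√(2 * Real.pi * v))⁻¹ ^ D)]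
    congr 2
    generalize (v / s) • (Xᵀ *ᵥ ((1 + (v / s) • (X * Xᵀ))⁻¹ *ᵥ y)) + d = b at hsq ⊢
    field_simp at hsq ⊢
    linear_combination (-1) * hsq
  simp_rw [key]
  rw [lintegral_const_mul' _ _ ENNReal.ofReal_ne_top, lintegral_exp_quadratic D hv hK, hdet,
    ← ENNReal.ofReal_mul (by positivity)]
  congr 1
  unfold outputDensity
  ring

/-! ### Measurability -/

instance (N D : ℕ) : BorelSpace (Matrix (Fin N) (Fin D) ℝ) :=
  inferInstanceAs (BorelSpace (Fin N → Fin D → ℝ))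

instance (N D : ℕ) : SecondCountableTopology (Matrix (Fin N) (Fin D) ℝ) :=
  inferInstanceAs (SecondCountableTopology (Fin N → Fin D → ℝ))

section Measurability

variable {N D : ℕ}

@[fun_prop]
lemma measurable_det_one_add (c : ℝ) :
    Measurable fun X : Matrix (Fin N) (Fin D) ℝ => (1 + c • (X * Xᵀ)).det :=
  Continuous.measurable (by fun_prop)

@[fun_prop]
lemma measurable_inv_apply (c : ℝ) (i j : Fin N) :
    Measurable fun X : Matrix (Fin N) (Fin D) ℝ =>
      ((1 + c • (X * Xᵀ))⁻¹ : Matrix (Fin N) (Fin N) ℝ) i j := by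
  simp only [inv_def, Ring.inverse_eq_inv', Matrix.smul_apply, smul_eq_mul]
  refine (measurable_det_one_add c).inv.mul (Continuous.measurable ?_)
  refine Continuous.matrix_elem ?_ i j
  fun_prop

lemma measurable_outputQuadratic (c : ℝ) :
    Measurable fun p : (Fin N → ℝ) × Matrix (Fin N) (Fin D) ℝ =>
      p.1 ⬝ᵥ (1 + c • (p.2 * p.2ᵀ))⁻¹ *ᵥ p.1 := by
  have h (i j : Fin N) : Measurable fun p : (Fin N → ℝ) × Matrix (Fin N) (Fin D) ℝ =>
      ((1 + c • (p.2 * p.2ᵀ))⁻¹ : Matrix (Fin N) (Fin N) ℝ) i j * p.1 j :=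
    ((measurable_inv_apply c i j).comp measurable_snd).mul (by fun_prop)
  have h' (i : Fin N) : Measurable fun p : (Fin N → ℝ) × Matrix (Fin N) (Fin D) ℝ =>
      p.1 i * ((1 + c • (p.2 * p.2ᵀ))⁻¹ *ᵥ p.1) i :=
    Measurable.mul (by fun_prop) (Finset.measurable_sum Finset.univ fun j _ => h i j)
  exact Finset.measurable_sum Finset.univ fun i _ => h' i

lemma measurable_outputDensity (s c : ℝ) :
    Measurable fun p : (Fin N → ℝ) × Matrix (Fin N) (Fin D) ℝ => outputDensity s c p.2 p.1 := by
  unfold outputDensity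
  refine Measurable.mul (Measurable.const_mul ?_ _) ?_
  · exact ((measurable_det_one_add c).comp measurable_snd).sqrt.inv
  · exact ((measurable_outputQuadratic c).neg.div_const _).exp

/-- The transition density of the channel. -/
noncomputable def channelDensity (N D : ℕ) (s : ℝ)
    (z : (Fin D → ℝ) × ((Fin N → ℝ) × Matrix (Fin N) (Fin D) ℝ)) : ℝ :=
  gaussDensity N s (z.2.1 - z.2.2 *ᵥ z.1)

@[fun_prop]
lemma measurable_channelDensity (N D : ℕ) (s : ℝ) : Measurable (channelDensity N D s) := by
  refine (continuous_gaussDensity N s).measurable.comp (Continuous.measurable ?_)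
  fun_prop

/-- The map from the input, the channel matrix and the noise to the input and the output. -/
def channelMap (N D : ℕ) (ω : (Fin D → ℝ) × (Matrix (Fin N) (Fin D) ℝ × (Fin N → ℝ))) :
    (Fin D → ℝ) × ((Fin N → ℝ) × Matrix (Fin N) (Fin D) ℝ) :=
  (ω.1, (linearOutput ω.2.1 ω.1 ω.2.2, ω.2.1))

@[fun_prop]
lemma measurable_channelMap (N D : ℕ) : Measurable (channelMap N D) := by
  refine Continuous.measurable ?_
  unfold channelMap linearOutput
  fun_prop

end Measurability

/-! ### Joint and output laws of the channel and their densities -/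

section Laws

variable {N D : ℕ} {s : ℝ}

/-- The law of the input, the channel matrix and the noise. -/
noncomputable abbrev sourceLaw (N D : ℕ) (s : ℝ) (μ : Measure (Fin D → ℝ)) :
    Measure ((Fin D → ℝ) × (Matrix (Fin N) (Fin D) ℝ × (Fin N → ℝ))) :=
  μ.prod ((gaussianMatrix N D).prod (isoGaussian N s))

/-- The joint law of the input and the output. -/
noncomputable def jointLaw (N D : ℕ) (s : ℝ) (μ : Measure (Fin D → ℝ)) :
    Measure ((Fin D → ℝ) × ((Fin N → ℝ) × Matrix (Fin N) (Fin D) ℝ)) :=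
  (sourceLaw N D s μ).map (channelMap N D)

/-- The law of the output. -/
noncomputable def outputLaw (N D : ℕ) (s : ℝ) (μ : Measure (Fin D → ℝ)) :
    Measure ((Fin N → ℝ) × Matrix (Fin N) (Fin D) ℝ) :=
  (jointLaw N D s μ).map Prod.snd

/-- The density of the output law with respect to the product of Lebesgue measure and the law of
the channel matrix. -/
noncomputable def marginalDensity (N D : ℕ) (s : ℝ) (μ : Measure (Fin D → ℝ))
    (z : (Fin N → ℝ) × Matrix (Fin N) (Fin D) ℝ) : ℝ :=
  (∫⁻ b, ENNReal.ofReal (channelDensity N D s (b, z)) ∂μ).toReal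

variable (μ : Measure (Fin D → ℝ))

/-- Given `β` and `X`, the output is the noise translated by `X β`. The reference measure keeps `μ`
itself in the input factor, so `μ` may be singular. -/
lemma jointLaw_eq_withDensity (hs : 0 < s) :
    jointLaw N D s μ = (μ.prod (volume.prod (gaussianMatrix N D))).withDensity
      (fun z => ENNReal.ofReal (channelDensity N D s z)) := by
  refine Measure.ext_of_lintegral _ fun f hf => ?_
  rw [jointLaw, lintegral_map hf (by fun_prop), lintegral_prod _ (by fun_prop),
    lintegral_withDensity_eq_lintegral_mul _ (by fun_prop) hf, lintegral_prod _ (by fun_prop)]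
  refine lintegral_congr fun b => ?_
  rw [lintegral_prod _ (by fun_prop), lintegral_prod_symm _ (by fun_prop)]
  refine lintegral_congr fun X => ?_
  have hg : Measurable fun e => f (channelMap N D (b, X, e)) := by fun_prop
  rw [isoGaussian_eq_withDensity N hs,
    lintegral_withDensity_eq_lintegral_mul _ (by fun_prop) hg]
  refine Eq.trans ?_ (lintegral_add_left_eq_self _ (X *ᵥ b))
  refine lintegral_congr fun e => ?_
  simp [channelDensity, channelMap, linearOutput]

lemma channelDensity_pos (hs : 0 < s)
    (z : (Fin D → ℝ) × ((Fin N → ℝ) × Matrix (Fin N) (Fin D) ℝ)) : 0 < channelDensity N D s z :=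
  gaussDensity_pos N hs _

lemma inputInformation_eq_klDiv (σ : ℝ) :
    inputInformation N D σ μ
      = klDiv (jointLaw N D (σ ^ 2) μ) (μ.prod (outputLaw N D (σ ^ 2) μ)) := by
  have h : (sourceLaw N D (σ ^ 2) μ).map Prod.fst = μ := by simp [sourceLaw]
  rw [outputLaw, jointLaw, Measure.map_map measurable_snd (by fun_prop)]
  -- The third `μ` is the input marginal in the product law; once it is a pushforward, both sides
  -- agree by definition.
  nth_rewrite 3 [← h]
  rfl

variable [IsProbabilityMeasure μ]

instance : IsProbabilityMeasure (jointLaw N D s μ) :=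
  Measure.isProbabilityMeasure_map (by fun_prop)

instance : IsProbabilityMeasure (outputLaw N D s μ) :=
  Measure.isProbabilityMeasure_map (by fun_prop)

lemma lintegral_channelDensity_le (hs : 0 < s) (z : (Fin N → ℝ) × Matrix (Fin N) (Fin D) ℝ) :
    ∫⁻ b, ENNReal.ofReal (channelDensity N D s (b, z)) ∂μ
      ≤ ENNReal.ofReal ((√(2 * Real.pi * s))⁻¹ ^ N) := by
  calc _ ≤ ∫⁻ _, ENNReal.ofReal ((√(2 * Real.pi * s))⁻¹ ^ N) ∂μ :=
        lintegral_mono fun b => ENNReal.ofReal_le_ofReal (gaussDensity_le N hs _)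
    _ = _ := by simp

lemma ofReal_marginalDensity (hs : 0 < s) (z : (Fin N → ℝ) × Matrix (Fin N) (Fin D) ℝ) :
    ENNReal.ofReal (marginalDensity N D s μ z)
      = ∫⁻ b, ENNReal.ofReal (channelDensity N D s (b, z)) ∂μ :=
  ENNReal.ofReal_toReal ((lintegral_channelDensity_le μ hs z).trans_lt ENNReal.ofReal_lt_top).ne

/-- An average of Gaussian densities stays below their common peak. This is the upper bound that
Gibbs' inequality requires. -/
lemma marginalDensity_le (hs : 0 < s) (z : (Fin N → ℝ) × Matrix (Fin N) (Fin D) ℝ) :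
    marginalDensity N D s μ z ≤ (√(2 * Real.pi * s))⁻¹ ^ N :=
  ENNReal.toReal_le_of_le_ofReal (by positivity) (lintegral_channelDensity_le μ hs z)

lemma marginalDensity_pos (hs : 0 < s) (z : (Fin N → ℝ) × Matrix (Fin N) (Fin D) ℝ) :
    0 < marginalDensity N D s μ z := by
  rw [← ENNReal.ofReal_pos, ofReal_marginalDensity μ hs, pos_iff_ne_zero, Ne,
    lintegral_eq_zero_iff (by fun_prop)]
  intro h
  obtain ⟨b, hb⟩ := h.exists
  exact (channelDensity_pos hs (b, z)).not_ge (ENNReal.ofReal_eq_zero.1 hb)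

@[fun_prop]
lemma measurable_marginalDensity : Measurable (marginalDensity N D s μ) := by
  unfold marginalDensity
  refine Measurable.ennreal_toReal ?_
  exact Measurable.lintegral_prod_left' (f := fun z => ENNReal.ofReal (channelDensity N D s z))
    (by fun_prop)

lemma outputLaw_eq_withDensity (hs : 0 < s) :
    outputLaw N D s μ = (volume.prod (gaussianMatrix N D)).withDensity
      (fun z => ENNReal.ofReal (marginalDensity N D s μ z)) := by
  refine Measure.ext_of_lintegral _ fun f hf => ?_
  rw [outputLaw, lintegral_map hf measurable_snd, jointLaw_eq_withDensity μ hs,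
    lintegral_withDensity_eq_lintegral_mul _ (by fun_prop) (by fun_prop),
    lintegral_prod_symm _ (by fun_prop),
    lintegral_withDensity_eq_lintegral_mul _ (by fun_prop) hf]
  refine lintegral_congr fun z => ?_
  simp only [Pi.mul_apply]
  rw [lintegral_mul_const _ (by fun_prop), ofReal_marginalDensity μ hs]

lemma marginalDensity_isoGaussian {v : ℝ} (hs : 0 < s) (hv : 0 < v)
    (z : (Fin N → ℝ) × Matrix (Fin N) (Fin D) ℝ) :
    marginalDensity N D s (isoGaussian D v) z = outputDensity s (v / s) z.2 z.1 := by
  rw [marginalDensity]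
  simp only [channelDensity]
  rw [lintegral_gaussDensity_sub_mulVec hs hv,
    ENNReal.toReal_ofReal (outputDensity_pos hs (by positivity) _ _).le]

lemma inputInformation_eq_integral {σ : ℝ} (hσ : 0 < σ)
    (hint : Integrable (fun z => Real.log (channelDensity N D (σ ^ 2) z)
      - Real.log (marginalDensity N D (σ ^ 2) μ z.2)) (jointLaw N D (σ ^ 2) μ)) :
    inputInformation N D σ μ = ENNReal.ofReal
      (∫ z, (Real.log (channelDensity N D (σ ^ 2) z)
        - Real.log (marginalDensity N D (σ ^ 2) μ z.2)) ∂(jointLaw N D (σ ^ 2) μ)) := by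
  have hs : 0 < σ ^ 2 := by positivity
  rw [inputInformation_eq_klDiv]
  refine klDiv_withDensity_withDensity (m := μ.prod (volume.prod (gaussianMatrix N D)))
    (by fun_prop) (by fun_prop) (channelDensity_pos hs)
    (fun z => marginalDensity_pos μ hs z.2) (jointLaw_eq_withDensity μ hs) ?_ hint
  rw [outputLaw_eq_withDensity μ hs, prod_withDensity_right (by fun_prop)]

end Laws

/-! ### Gaussian moments -/

section Moments

lemma memLp_coord_isoGaussian (n : ℕ) (v : ℝ) (i : Fin n) :
    MemLp (fun x : Fin n → ℝ => x i) 2 (isoGaussian n v) :=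
  (memLp_id_gaussianReal 2).comp_measurePreserving
    (measurePreserving_eval (fun _ : Fin n => gaussianReal 0 v.toNNReal) i)

lemma integrable_coord_isoGaussian (n : ℕ) (v : ℝ) (i : Fin n) :
    Integrable (fun x : Fin n → ℝ => x i) (isoGaussian n v) :=
  (memLp_coord_isoGaussian n v i).integrable (by norm_num)

lemma integrable_coord_mul_isoGaussian (n : ℕ) (v : ℝ) (i j : Fin n) :
    Integrable (fun x : Fin n → ℝ => x i * x j) (isoGaussian n v) :=
  (memLp_coord_isoGaussian n v i).integrable_mul (memLp_coord_isoGaussian n v j)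

lemma integral_coord_isoGaussian (n : ℕ) (v : ℝ) (i : Fin n) :
    ∫ x, x i ∂(isoGaussian n v) = 0 := by
  have := integral_comp_eval (μ := fun _ : Fin n => gaussianReal 0 v.toNNReal) (i := i)
    (f := id) aestronglyMeasurable_id
  simpa [isoGaussian] using this

lemma integral_coord_mul_isoGaussian (n : ℕ) {v : ℝ} (hv : 0 ≤ v) (i j : Fin n) :
    ∫ x, x i * x j ∂(isoGaussian n v) = if i = j then v else 0 := by
  split_ifs with h
  · subst h
    have := integral_comp_eval (μ := fun _ : Fin n => gaussianReal 0 v.toNNReal) (i := i)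
      (f := fun x => x * x) (by fun_prop)
    rw [isoGaussian, this]
    have h2 := variance_eq_integral (μ := gaussianReal 0 v.toNNReal) (X := id) (by fun_prop)
    rw [variance_id_gaussianReal] at h2
    simp only [id_eq, integral_id_gaussianReal, sub_zero, Real.coe_toNNReal v hv] at h2
    simp_rw [← pow_two]
    exact h2.symm
  · have hind : iIndepFun (fun (i : Fin n) (x : Fin n → ℝ) => x i) (isoGaussian n v) :=
      iIndepFun_pi (X := fun _ x => x) (fun _ => aemeasurable_id)
    rw [(hind.indepFun h).integral_fun_mul_eq_mul_integral
        (measurable_pi_apply i).aestronglyMeasurable (measurable_pi_apply j).aestronglyMeasurable,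
      integral_coord_isoGaussian, zero_mul]

lemma integrable_dotProduct_self_isoGaussian (n : ℕ) (v : ℝ) :
    Integrable (fun x => x ⬝ᵥ x) (isoGaussian n v) :=
  integrable_finsetSum _ fun i _ => integrable_coord_mul_isoGaussian n v i i

lemma integral_dotProduct_self_isoGaussian (n : ℕ) {v : ℝ} (hv : 0 ≤ v) :
    ∫ x, x ⬝ᵥ x ∂(isoGaussian n v) = n * v := by
  simp only [dotProduct]
  rw [integral_finsetSum _ fun i _ => integrable_coord_mul_isoGaussian n v i i]
  simp [integral_coord_mul_isoGaussian n hv]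

/-- The terms linear in `e` vanish because the mean is zero, and the covariance `v I` turns the
quadratic term into a trace. -/
lemma integral_quadratic_add_isoGaussian {n : ℕ} {v : ℝ} (hv : 0 ≤ v)
    (W : Matrix (Fin n) (Fin n) ℝ) (u : Fin n → ℝ) :
    ∫ e, (u + e) ⬝ᵥ W *ᵥ (u + e) ∂(isoGaussian n v) = u ⬝ᵥ W *ᵥ u + v * W.trace := by
  have hi (i j : Fin n) : Integrable
      (fun e : Fin n → ℝ => u i * W i j * u j + (u i * W i j * e j + W i j * u j * e i)
        + W i j * (e i * e j)) (isoGaussian n v) :=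
    ((integrable_const _).add (((integrable_coord_isoGaussian n v j).const_mul _).add
      ((integrable_coord_isoGaussian n v i).const_mul _))).add
      ((integrable_coord_mul_isoGaussian n v i j).const_mul _)
  have h (i j : Fin n) : ∫ e : Fin n → ℝ, (u i * W i j * u j +
      (u i * W i j * e j + W i j * u j * e i) + W i j * (e i * e j)) ∂(isoGaussian n v)
      = u i * W i j * u j + W i j * (if i = j then v else 0) := by
    have h1 := (integrable_coord_isoGaussian n v j).const_mul (u i * W i j)
    have h2 := (integrable_coord_isoGaussian n v i).const_mul (W i j * u j)
    have h3 := (integrable_coord_mul_isoGaussian n v i j).const_mul (W i j)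
    have h0 := integrable_const (μ := isoGaussian n v) (u i * W i j * u j)
    have h12 : Integrable (fun e : Fin n → ℝ => u i * W i j * e j + W i j * u j * e i)
        (isoGaussian n v) := h1.add h2
    have h012 : Integrable (fun e : Fin n → ℝ => u i * W i j * u j +
        (u i * W i j * e j + W i j * u j * e i)) (isoGaussian n v) := h0.add h12
    rw [integral_add h012 h3, integral_add h0 h12, integral_add h1 h2,
      integral_const, integral_const_mul, integral_const_mul, integral_const_mul,
      integral_coord_isoGaussian,
      integral_coord_isoGaussian, integral_coord_mul_isoGaussian n hv]
    simp
  have hexp (e : Fin n → ℝ) : (u + e) ⬝ᵥ W *ᵥ (u + e) = ∑ i, ∑ j,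
      (u i * W i j * u j + (u i * W i j * e j + W i j * u j * e i) + W i j * (e i * e j)) := by
    simp only [dotProduct, mulVec, Finset.mul_sum, Pi.add_apply]
    refine Finset.sum_congr rfl fun i _ => Finset.sum_congr rfl fun j _ => ?_
    ring
  simp_rw [hexp]
  rw [integral_finsetSum _ fun i _ => integrable_finsetSum _ fun j _ => hi i j]
  simp_rw [integral_finsetSum Finset.univ fun j _ => hi _ j, h, Finset.sum_add_distrib]
  congr 1
  · simp [dotProduct, mulVec, Finset.mul_sum, mul_assoc]
  · simp [trace, Finset.mul_sum, mul_comm]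

variable {N D : ℕ}

lemma gaussianMatrix_eq (N D : ℕ) :
    gaussianMatrix N D = Measure.pi (fun _ : Fin N => isoGaussian D 1) := by
  simp only [gaussianMatrix, isoGaussian, Real.toNNReal_one]
  rfl

lemma integrable_entry_sq (i : Fin N) (j : Fin D) :
    Integrable (fun X : Matrix (Fin N) (Fin D) ℝ => X i j ^ 2) (gaussianMatrix N D) := by
  rw [gaussianMatrix_eq]
  simp_rw [pow_two]
  exact (measurePreserving_eval (fun _ : Fin N => isoGaussian D 1) i).integrable_comp_of_integrable
    (integrable_coord_mul_isoGaussian D 1 j j)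

/-- The squared Frobenius norm of the channel matrix is integrable. -/
lemma integrable_sum_entry_sq : Integrable
    (fun X : Matrix (Fin N) (Fin D) ℝ => ∑ i, ∑ j, X i j ^ 2) (gaussianMatrix N D) :=
  integrable_finsetSum _ fun i _ => integrable_finsetSum _ fun j _ => integrable_entry_sq i j

lemma mulVec_dotProduct_self_le (X : Matrix (Fin N) (Fin D) ℝ) (b : Fin D → ℝ) :
    (X *ᵥ b) ⬝ᵥ (X *ᵥ b) ≤ (b ⬝ᵥ b) * ∑ i, ∑ j, X i j ^ 2 := by
  rw [Finset.mul_sum, dotProduct]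
  refine Finset.sum_le_sum fun i _ => ?_
  have := Finset.sum_mul_sq_le_sq_mul_sq Finset.univ (X i) b
  simp only [dotProduct, mulVec, ← pow_two]
  linarith

/-! ### Column symmetries and the expected gain matrix -/

lemma measurePreserving_colSign (ε : Fin D → ℝ) (hε : ∀ j, ε j = 1 ∨ ε j = -1) :
    MeasurePreserving (fun X : Matrix (Fin N) (Fin D) ℝ => X * diagonal ε)
      (gaussianMatrix N D) (gaussianMatrix N D) := by
  have h1 (j : Fin D) : MeasurePreserving (fun x : ℝ => x * ε j) (gaussianReal 0 1)
      (gaussianReal 0 1) := by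
    refine ⟨by fun_prop, ?_⟩
    rw [gaussianReal_map_mul_const]
    congr 1
    · simp
    · ext
      rcases hε j with h | h <;> simp [h]
  have h2 := measurePreserving_pi (fun _ : Fin N => Measure.pi fun _ : Fin D => gaussianReal 0 1)
    (fun _ : Fin N => Measure.pi fun _ : Fin D => gaussianReal 0 1)
    (fun _ => measurePreserving_pi _ _ h1)
  have h3 : (fun X : Matrix (Fin N) (Fin D) ℝ => X * diagonal ε) = fun X i j => X i j * ε j := by
    ext X i j
    simp
  rw [h3]
  exact h2

lemma measurePreserving_colPerm (π : Equiv.Perm (Fin D)) :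
    MeasurePreserving (fun X : Matrix (Fin N) (Fin D) ℝ => X.submatrix id π)
      (gaussianMatrix N D) (gaussianMatrix N D) := by
  have h1 := measurePreserving_piCongrLeft (fun _ : Fin D => gaussianReal 0 1) π.symm
  have h2 := measurePreserving_pi (fun _ : Fin N => Measure.pi fun _ : Fin D => gaussianReal 0 1)
    (fun _ : Fin N => Measure.pi fun _ : Fin D => gaussianReal 0 1) (fun _ => h1)
  have h3 : (fun X : Matrix (Fin N) (Fin D) ℝ => X.submatrix id π)
      = fun X i => MeasurableEquiv.piCongrLeft (fun _ : Fin D => ℝ) π.symm (X i) := by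
    ext X i j
    simp [MeasurableEquiv.piCongrLeft, Equiv.piCongrLeft_apply]
  rw [h3]
  exact h2

/-- The matrix `Xᵀ (I + c X Xᵀ)⁻¹ X`. -/
noncomputable def gainMatrix (c : ℝ) (X : Matrix (Fin N) (Fin D) ℝ) :
    Matrix (Fin D) (Fin D) ℝ :=
  Xᵀ * (1 + c • (X * Xᵀ))⁻¹ * X

lemma dotProduct_gainMatrix (c : ℝ) (X : Matrix (Fin N) (Fin D) ℝ) (b : Fin D → ℝ) :
    b ⬝ᵥ gainMatrix c X *ᵥ b = (X *ᵥ b) ⬝ᵥ (1 + c • (X * Xᵀ))⁻¹ *ᵥ (X *ᵥ b) := by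
  rw [gainMatrix, mulVec_dotProduct_eq, mulVec_mulVec, mulVec_mulVec, Matrix.mul_assoc]

lemma gainMatrix_symm (c : ℝ) (X : Matrix (Fin N) (Fin D) ℝ) (i j : Fin D) :
    gainMatrix c X i j = gainMatrix c X j i := by
  have : (gainMatrix c X)ᵀ = gainMatrix c X := by
    rw [gainMatrix, transpose_mul, transpose_mul, inv_transpose_eq, transpose_transpose,
      Matrix.mul_assoc]
  exact congrFun (congrFun this j) i

lemma gainMatrix_mul_diagonal (c : ℝ) (X : Matrix (Fin N) (Fin D) ℝ) {ε : Fin D → ℝ}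
    (hε : ∀ j, ε j = 1 ∨ ε j = -1) (i j : Fin D) :
    gainMatrix c (X * diagonal ε) i j = ε i * ε j * gainMatrix c X i j := by
  have h : diagonal ε * diagonal ε = (1 : Matrix (Fin D) (Fin D) ℝ) := by
    rw [diagonal_mul_diagonal, ← diagonal_one]
    congr 1
    ext j
    rcases hε j with h | h <;> simp [h]
  have h2 : (X * diagonal ε) * (X * diagonal ε)ᵀ = X * Xᵀ := by
    rw [transpose_mul, diagonal_transpose, Matrix.mul_assoc, ← Matrix.mul_assoc (diagonal ε), h,
      Matrix.one_mul]
  have h3 : gainMatrix c (X * diagonal ε) = diagonal ε * gainMatrix c X * diagonal ε := by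
    simp only [gainMatrix, h2]
    simp only [transpose_mul, diagonal_transpose, Matrix.mul_assoc]
  rw [h3, mul_diagonal, diagonal_mul]
  ring

lemma gainMatrix_submatrix (c : ℝ) (X : Matrix (Fin N) (Fin D) ℝ) (π : Equiv.Perm (Fin D))
    (i j : Fin D) : gainMatrix c (X.submatrix id π) i j = gainMatrix c X (π i) (π j) := by
  have h2 : (X.submatrix id π) * (X.submatrix id π)ᵀ = X * Xᵀ := by
    rw [transpose_submatrix, submatrix_mul_equiv, submatrix_id_id]
  simp only [gainMatrix, h2]
  simp [mul_apply]

lemma measurable_gainMatrix (c : ℝ) (i j : Fin D) :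
    Measurable fun X : Matrix (Fin N) (Fin D) ℝ => gainMatrix c X i j := by
  have hX (k : Fin N) (l : Fin D) : Measurable fun X : Matrix (Fin N) (Fin D) ℝ => X k l :=
    (measurable_pi_apply l).comp (measurable_pi_apply k)
  simp only [gainMatrix, mul_apply, transpose_apply]
  exact Finset.measurable_sum _ fun k _ => (Finset.measurable_sum _ fun l _ =>
    (hX l i).mul (measurable_inv_apply c l k)).mul (hX k j)

lemma integrable_dotProduct_gainMatrix {c : ℝ} (hc : 0 ≤ c) (b : Fin D → ℝ) :
    Integrable (fun X : Matrix (Fin N) (Fin D) ℝ => b ⬝ᵥ gainMatrix c X *ᵥ b)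
      (gaussianMatrix N D) := by
  refine (integrable_sum_entry_sq.const_mul (b ⬝ᵥ b)).mono' ?_ (ae_of_all _ fun X => ?_)
  · refine Measurable.aestronglyMeasurable ?_
    simp only [dotProduct, mulVec]
    exact Finset.measurable_sum _ fun i _ => measurable_const.mul
      (Finset.measurable_sum _ fun j _ => (measurable_gainMatrix c i j).mul_const _)
  · rw [dotProduct_gainMatrix, Real.norm_of_nonneg (dotProduct_inv_mulVec_nonneg X hc _)]
    exact (dotProduct_inv_mulVec_le X hc _).trans (mulVec_dotProduct_self_le X b)

lemma integrable_gainMatrix {c : ℝ} (hc : 0 ≤ c) (i j : Fin D) :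
    Integrable (fun X : Matrix (Fin N) (Fin D) ℝ => gainMatrix c X i j) (gaussianMatrix N D) := by
  have h1 := integrable_dotProduct_gainMatrix (N := N) hc (Pi.single i 1 + Pi.single j 1)
  have h2 := integrable_dotProduct_gainMatrix (N := N) hc (Pi.single i 1)
  have h3 := integrable_dotProduct_gainMatrix (N := N) hc (Pi.single j 1)
  -- Polarization: an entry of a symmetric matrix is a combination of values of its quadratic form.
  refine (((h1.sub h2).sub h3).div_const 2).congr (ae_of_all _ fun X => ?_)
  simp only [Pi.sub_apply, mulVec_add, dotProduct_add, add_dotProduct, mulVec_single_one,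
    single_one_dotProduct, col_apply]
  rw [gainMatrix_symm c X j i]
  ring

/-- Negating column `i` preserves the law of `X` and negates this entry, so its mean equals its own
negative. -/
lemma integral_gainMatrix_of_ne (c : ℝ) {i j : Fin D} (hij : i ≠ j) :
    ∫ X : Matrix (Fin N) (Fin D) ℝ, gainMatrix c X i j ∂(gaussianMatrix N D) = 0 := by
  set ε : Fin D → ℝ := fun k => if k = i then -1 else 1 with hεdef
  have hε (k : Fin D) : ε k = 1 ∨ ε k = -1 := by
    by_cases h : k = i <;> simp [hεdef, h]
  have hmp := measurePreserving_colSign (N := N) ε hε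
  have h := integral_map (μ := gaussianMatrix N D) hmp.measurable.aemeasurable
    (measurable_gainMatrix c i j).aestronglyMeasurable
  rw [hmp.map_eq] at h
  simp_rw [gainMatrix_mul_diagonal c _ hε] at h
  simp [hεdef, hij.symm, integral_neg] at h
  linarith

lemma integral_gainMatrix_diag_eq (c : ℝ) (i j : Fin D) :
    ∫ X : Matrix (Fin N) (Fin D) ℝ, gainMatrix c X i i ∂(gaussianMatrix N D)
      = ∫ X : Matrix (Fin N) (Fin D) ℝ, gainMatrix c X j j ∂(gaussianMatrix N D) := by
  have hmp := measurePreserving_colPerm (N := N) (Equiv.swap i j)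
  have h := integral_map (μ := gaussianMatrix N D) hmp.measurable.aemeasurable
    (measurable_gainMatrix c i i).aestronglyMeasurable
  rw [hmp.map_eq] at h
  simpa [gainMatrix_submatrix] using h

/-- The mean gain matrix has zero off-diagonal entries and equal diagonal entries, so it is the
identity times its trace over `D`. Hence the mean received signal depends on `b` only through
`|b|²`. -/
lemma integral_dotProduct_gainMatrix (hD : 0 < D) {c : ℝ} (hc : 0 ≤ c) (b : Fin D → ℝ) :
    ∫ X : Matrix (Fin N) (Fin D) ℝ, b ⬝ᵥ gainMatrix c X *ᵥ b ∂(gaussianMatrix N D)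
      = (∫ X : Matrix (Fin N) (Fin D) ℝ, (gainMatrix c X).trace ∂(gaussianMatrix N D)) / D
        * (b ⬝ᵥ b) := by
  have hint (i j : Fin D) :=
    ((integrable_gainMatrix (N := N) hc i j).mul_const (b j)).const_mul (b i)
  have htr : ∫ X : Matrix (Fin N) (Fin D) ℝ, (gainMatrix c X).trace ∂(gaussianMatrix N D)
      = D * ∫ X : Matrix (Fin N) (Fin D) ℝ, gainMatrix c X ⟨0, hD⟩ ⟨0, hD⟩
        ∂(gaussianMatrix N D) := by
    simp only [trace, diag_apply]
    rw [integral_finsetSum _ fun i _ => integrable_gainMatrix hc i i,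
      Finset.sum_congr rfl fun i _ => integral_gainMatrix_diag_eq c i ⟨0, hD⟩]
    simp
  have hD' : (D : ℝ) ≠ 0 := by positivity
  rw [htr, mul_div_cancel_left₀ _ hD']
  simp only [dotProduct, mulVec, Finset.mul_sum]
  rw [integral_finsetSum _ fun i _ => integrable_finsetSum _ fun j _ => hint i j]
  refine Finset.sum_congr rfl fun i _ => ?_
  rw [integral_finsetSum _ fun j _ => hint i j, Finset.sum_eq_single i]
  · rw [integral_const_mul, integral_mul_const, integral_gainMatrix_diag_eq c i ⟨0, hD⟩]
    ring
  · intro j _ hj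
    rw [integral_const_mul, integral_mul_const, integral_gainMatrix_of_ne c hj.symm]
    simp
  · simp

end Moments

/-! ### The capacity: upper bound and attainment -/

section Capacity

variable {N D : ℕ} {s c : ℝ}

lemma integrable_log_det (hc : 0 ≤ c) :
    Integrable (fun X : Matrix (Fin N) (Fin D) ℝ => Real.log (1 + c • (X * Xᵀ)).det)
      (gaussianMatrix N D) := by
  refine (integrable_sum_entry_sq.const_mul c).mono'
    (measurable_det_one_add c).log.aestronglyMeasurable (ae_of_all _ fun X => ?_)
  rw [Real.norm_of_nonneg (log_det_nonneg X hc)]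
  exact log_det_le X hc

lemma integrable_trace_gainMatrix (hc : 0 ≤ c) :
    Integrable (fun X : Matrix (Fin N) (Fin D) ℝ => (gainMatrix c X).trace)
      (gaussianMatrix N D) :=
  integrable_finsetSum _ fun i _ => integrable_gainMatrix hc i i

lemma trace_inv_eq (hc : 0 ≤ c) (X : Matrix (Fin N) (Fin D) ℝ) :
    ((1 + c • (X * Xᵀ))⁻¹).trace = N - c * (gainMatrix c X).trace := by
  have := trace_inv_add X hc
  rw [Fintype.card_fin] at this
  rw [gainMatrix]
  linarith

/-- The quadratic form of the output in the exponent of `outputDensity`. -/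
noncomputable def outputQuadratic (c : ℝ) (z : (Fin N → ℝ) × Matrix (Fin N) (Fin D) ℝ) : ℝ :=
  z.1 ⬝ᵥ (1 + c • (z.2 * z.2ᵀ))⁻¹ *ᵥ z.1

lemma outputQuadratic_nonneg (hc : 0 ≤ c) (z : (Fin N → ℝ) × Matrix (Fin N) (Fin D) ℝ) :
    0 ≤ outputQuadratic c z :=
  dotProduct_inv_mulVec_nonneg z.2 hc z.1

lemma measurable_outputQuadratic_channelMap (c : ℝ) :
    Measurable fun ω => outputQuadratic c (channelMap N D ω).2 :=
  (measurable_outputQuadratic c).comp (measurable_snd.comp (measurable_channelMap N D))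

/-- Drop `A⁻¹ ≤ I`, then use `|u + e|² ≤ 2|u|² + 2|e|²` and Cauchy-Schwarz on `u = X β`. The bound
is a sum of products of functions of independent variables. -/
lemma outputQuadratic_le (hc : 0 ≤ c)
    (ω : (Fin D → ℝ) × (Matrix (Fin N) (Fin D) ℝ × (Fin N → ℝ))) :
    outputQuadratic c (channelMap N D ω).2
      ≤ 2 * ((ω.1 ⬝ᵥ ω.1) * ∑ i, ∑ j, ω.2.1 i j ^ 2) + 2 * (ω.2.2 ⬝ᵥ ω.2.2) := by
  obtain ⟨b, X, e⟩ := ω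
  refine (dotProduct_inv_mulVec_le X hc _).trans ?_
  simp only [channelMap, linearOutput]
  have h1 := mulVec_dotProduct_self_le X b
  have h2 := dotProduct_self_nonneg' (X *ᵥ b - e)
  simp only [sub_dotProduct, dotProduct_sub, add_dotProduct, dotProduct_add] at h2 ⊢
  linarith

lemma integrable_outputQuadratic_snd (hc : 0 ≤ c) (b : Fin D → ℝ) :
    Integrable (fun p => outputQuadratic c (channelMap N D (b, p)).2)
      ((gaussianMatrix N D).prod (isoGaussian N s)) := by
  refine Integrable.mono' (g := fun p => 2 * ((b ⬝ᵥ b) * ∑ i, ∑ j, p.1 i j ^ 2)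
    + 2 * (p.2 ⬝ᵥ p.2)) ?_ ?_ (ae_of_all _ fun p => ?_)
  · exact (((integrable_sum_entry_sq.const_mul _).const_mul _).comp_fst _).add
      (((integrable_dotProduct_self_isoGaussian N s).const_mul 2).comp_snd _)
  · exact ((measurable_outputQuadratic_channelMap c).comp
      measurable_prodMk_left).aestronglyMeasurable
  · rw [Real.norm_of_nonneg (outputQuadratic_nonneg hc _)]
    exact outputQuadratic_le hc (b, p)

/-- Averaging the noise leaves the signal form `b ⬝ᵥ G b` plus `s tr A⁻¹ = s (N - c tr G)`;
averaging `X` then makes the signal form isotropic. -/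
lemma integral_outputQuadratic_snd (hD : 0 < D) (hs : 0 ≤ s) (hc : 0 ≤ c) (b : Fin D → ℝ) :
    ∫ p, outputQuadratic c (channelMap N D (b, p)).2
        ∂((gaussianMatrix N D).prod (isoGaussian N s))
      = s * N + (b ⬝ᵥ b / D - s * c) *
        ∫ X : Matrix (Fin N) (Fin D) ℝ, (gainMatrix c X).trace ∂(gaussianMatrix N D) := by
  rw [integral_prod _ (integrable_outputQuadratic_snd hc b)]
  have h (X : Matrix (Fin N) (Fin D) ℝ) :
      ∫ e, outputQuadratic c (channelMap N D (b, X, e)).2 ∂(isoGaussian N s)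
        = b ⬝ᵥ gainMatrix c X *ᵥ b + (s * N - s * c * (gainMatrix c X).trace) := by
    rw [dotProduct_gainMatrix, mul_assoc, ← mul_sub, ← trace_inv_eq hc]
    have := integral_quadratic_add_isoGaussian hs
      ((1 + c • (X * Xᵀ))⁻¹ : Matrix (Fin N) (Fin N) ℝ) (X *ᵥ b)
    exact this
  have h1 := integrable_dotProduct_gainMatrix (N := N) hc b
  have h2 := (integrable_trace_gainMatrix (N := N) (D := D) hc).const_mul (s * c)
  have h3 := integrable_const (μ := gaussianMatrix N D) (s * N)
  have h23 : Integrable (fun X : Matrix (Fin N) (Fin D) ℝ =>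
    s * N - s * c * (gainMatrix c X).trace) (gaussianMatrix N D) := h3.sub h2
  simp_rw [h]
  rw [integral_add h1 h23, integral_sub h3 h2, integral_const, integral_const_mul,
    integral_dotProduct_gainMatrix hD hc]
  simp
  ring

lemma integral_outputLaw (μ : Measure (Fin D → ℝ))
    {g : (Fin N → ℝ) × Matrix (Fin N) (Fin D) ℝ → ℝ} (hg : Measurable g) :
    ∫ z, g z ∂(outputLaw N D s μ) = ∫ z, g z.2 ∂(jointLaw N D s μ) :=
  integral_map measurable_snd.aemeasurable hg.aestronglyMeasurable

lemma integrable_outputLaw_iff {μ : Measure (Fin D → ℝ)}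
    {g : (Fin N → ℝ) × Matrix (Fin N) (Fin D) ℝ → ℝ}
    (hg : Measurable g) :
    Integrable g (outputLaw N D s μ) ↔ Integrable (fun z => g z.2) (jointLaw N D s μ) :=
  integrable_map_measure hg.aestronglyMeasurable measurable_snd.aemeasurable

variable {μ : Measure (Fin D → ℝ)} [IsProbabilityMeasure μ]

lemma integrable_outputQuadratic (hc : 0 ≤ c) (hμ : Integrable (fun b => b ⬝ᵥ b) μ) :
    Integrable (fun ω => outputQuadratic c (channelMap N D ω).2) (sourceLaw N D s μ) := by
  refine Integrable.mono' (g := fun ω => 2 * ((ω.1 ⬝ᵥ ω.1) * ∑ i, ∑ j, ω.2.1 i j ^ 2)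
    + 2 * (ω.2.2 ⬝ᵥ ω.2.2)) ?_ ?_ (ae_of_all _ fun ω => ?_)
  · exact ((hμ.mul_prod (integrable_sum_entry_sq.comp_fst (isoGaussian N s))).const_mul 2).add
      ((((integrable_dotProduct_self_isoGaussian N s).const_mul 2).comp_snd
        (gaussianMatrix N D)).comp_snd μ)
  · exact (measurable_outputQuadratic_channelMap c).aestronglyMeasurable
  · rw [Real.norm_of_nonneg (outputQuadratic_nonneg hc _)]
    exact outputQuadratic_le hc ω

lemma integral_outputQuadratic (hD : 0 < D) (hs : 0 ≤ s) (hc : 0 ≤ c)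
    (hμ : Integrable (fun b => b ⬝ᵥ b) μ) :
    ∫ ω, outputQuadratic c (channelMap N D ω).2 ∂(sourceLaw N D s μ)
      = s * N + ((∫ b, b ⬝ᵥ b ∂μ) / D - s * c) *
        ∫ X : Matrix (Fin N) (Fin D) ℝ, (gainMatrix c X).trace ∂(gaussianMatrix N D) := by
  rw [integral_prod _ (integrable_outputQuadratic hc hμ)]
  simp_rw [integral_outputQuadratic_snd hD hs hc]
  have h1 : Integrable (fun b => b ⬝ᵥ b / D - s * c) μ :=
    (hμ.div_const _).sub (integrable_const _)
  rw [integral_add (integrable_const _) (h1.mul_const _), integral_const, integral_mul_const,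
    integral_sub (hμ.div_const _) (integrable_const _), integral_div]
  simp

lemma integral_trace_gainMatrix_nonneg (hc : 0 ≤ c) :
    0 ≤ ∫ X : Matrix (Fin N) (Fin D) ℝ, (gainMatrix c X).trace ∂(gaussianMatrix N D) := by
  refine integral_nonneg fun X => Finset.sum_nonneg fun i _ => ?_
  have := dotProduct_inv_mulVec_nonneg X hc (X *ᵥ Pi.single i 1)
  rw [← dotProduct_gainMatrix] at this
  simpa using this

lemma log_channelDensity (hs : 0 < s)
    (ω : (Fin D → ℝ) × (Matrix (Fin N) (Fin D) ℝ × (Fin N → ℝ))) :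
    Real.log (channelDensity N D s (channelMap N D ω))
      = -(N * Real.log (√(2 * Real.pi * s))) - (ω.2.2 ⬝ᵥ ω.2.2) / (2 * s) := by
  rw [channelDensity, log_gaussDensity N hs]
  simp [channelMap, linearOutput]

lemma integrable_noise :
    Integrable (fun ω => ω.2.2 ⬝ᵥ ω.2.2) (sourceLaw N D s μ) :=
  ((integrable_dotProduct_self_isoGaussian N s).comp_snd (gaussianMatrix N D)).comp_snd μ

lemma integral_noise (hs : 0 ≤ s) :
    ∫ ω, ω.2.2 ⬝ᵥ ω.2.2 ∂(sourceLaw N D s μ) = N * s := by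
  have h := integral_fun_snd (μ := μ) (ν := (gaussianMatrix N D).prod (isoGaussian N s))
    (fun p => p.2 ⬝ᵥ p.2)
  have h2 := integral_fun_snd (μ := gaussianMatrix N D) (ν := isoGaussian N s) (fun e => e ⬝ᵥ e)
  rw [h, h2, integral_dotProduct_self_isoGaussian N hs]
  simp

lemma integrable_log_channelDensity (hs : 0 < s) :
    Integrable (fun z => Real.log (channelDensity N D s z)) (jointLaw N D s μ) := by
  rw [jointLaw, integrable_map_measure
    (measurable_channelDensity N D s).log.aestronglyMeasurable (by fun_prop)]
  simp only [Function.comp_def, log_channelDensity hs]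
  exact (integrable_const _).sub (integrable_noise.div_const _)

lemma integrable_log_outputDensity (hs : 0 < s) (hc : 0 ≤ c)
    (hμ : Integrable (fun b => b ⬝ᵥ b) μ) :
    Integrable (fun z => Real.log (outputDensity s c z.2.2 z.2.1)) (jointLaw N D s μ) := by
  have hm : Measurable fun z : (Fin D → ℝ) × ((Fin N → ℝ) × Matrix (Fin N) (Fin D) ℝ) =>
      Real.log (outputDensity s c z.2.2 z.2.1) :=
    ((measurable_outputDensity s c).comp measurable_snd).log
  rw [jointLaw]
  refine (integrable_map_measure hm.aestronglyMeasurable (by fun_prop)).2 ?_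
  simp only [Function.comp_def, log_outputDensity hs hc]
  have h1 : Integrable (fun ω => Real.log (1 + c • (ω.2.1 * ω.2.1ᵀ)).det / 2)
      (sourceLaw N D s μ) :=
    (((integrable_log_det hc).div_const 2).comp_fst (isoGaussian N s)).comp_snd μ
  exact ((integrable_const _).sub h1).sub ((integrable_outputQuadratic hc hμ).div_const _)

/-- The information of a channel with Gaussian reference output law. -/
lemma integral_log_channelDensity_sub (hD : 0 < D) (hs : 0 < s) (hc : 0 ≤ c)
    (hμ : Integrable (fun b => b ⬝ᵥ b) μ) :
    ∫ z, (Real.log (channelDensity N D s z) - Real.log (outputDensity s c z.2.2 z.2.1))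
        ∂(jointLaw N D s μ)
      = 1 / 2 * (∫ X : Matrix (Fin N) (Fin D) ℝ, Real.log (1 + c • (X * Xᵀ)).det
          ∂(gaussianMatrix N D))
        + ((∫ b, b ⬝ᵥ b ∂μ) / D - s * c) *
          (∫ X : Matrix (Fin N) (Fin D) ℝ, (gainMatrix c X).trace ∂(gaussianMatrix N D))
          / (2 * s) := by
  have hm : Measurable fun z : (Fin D → ℝ) × ((Fin N → ℝ) × Matrix (Fin N) (Fin D) ℝ) =>
      Real.log (outputDensity s c z.2.2 z.2.1) :=
    ((measurable_outputDensity s c).comp measurable_snd).log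
  have hm' : Measurable fun z => Real.log (channelDensity N D s z) := by fun_prop
  rw [jointLaw]
  refine (integral_map (by fun_prop) (hm'.sub hm).aestronglyMeasurable).trans ?_
  have h (ω : (Fin D → ℝ) × (Matrix (Fin N) (Fin D) ℝ × (Fin N → ℝ))) :
      Real.log (channelDensity N D s (channelMap N D ω)) - Real.log
        (outputDensity s c (channelMap N D ω).2.2 (channelMap N D ω).2.1)
      = Real.log (1 + c • (ω.2.1 * ω.2.1ᵀ)).det / 2 +
        (outputQuadratic c (channelMap N D ω).2 / (2 * s) - (ω.2.2 ⬝ᵥ ω.2.2) / (2 * s)) := by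
    rw [log_channelDensity hs, log_outputDensity hs hc, outputQuadratic]
    simp only [channelMap]
    ring
  have h1 : Integrable (fun ω => Real.log (1 + c • (ω.2.1 * ω.2.1ᵀ)).det / 2)
      (sourceLaw N D s μ) :=
    (((integrable_log_det hc).div_const 2).comp_fst (isoGaussian N s)).comp_snd μ
  have h2 := (integrable_outputQuadratic (N := N) (s := s) hc hμ).div_const (2 * s)
  have h3 := (integrable_noise (N := N) (s := s) (μ := μ)).div_const (2 * s)
  have h23 : Integrable (fun ω => outputQuadratic c (channelMap N D ω).2 / (2 * s)
    - (ω.2.2 ⬝ᵥ ω.2.2) / (2 * s)) (sourceLaw N D s μ) := h2.sub h3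
  have h4 : ∫ ω, Real.log (1 + c • (ω.2.1 * ω.2.1ᵀ)).det ∂(sourceLaw N D s μ)
      = ∫ X : Matrix (Fin N) (Fin D) ℝ, Real.log (1 + c • (X * Xᵀ)).det
        ∂(gaussianMatrix N D) := by
    have h := integral_fun_snd (μ := μ) (ν := (gaussianMatrix N D).prod (isoGaussian N s))
      (fun p => Real.log (1 + c • (p.1 * p.1ᵀ)).det)
    have h2 := integral_fun_fst (μ := gaussianMatrix N D) (ν := isoGaussian N s)
      (fun X => Real.log (1 + c • (X * Xᵀ)).det)
    rw [h, h2]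
    simp
  refine (integral_congr_ae (ae_of_all _ h)).trans ?_
  rw [integral_add h1 h23, integral_sub h2 h3, integral_div, integral_div, integral_div, h4,
    integral_noise hs.le, integral_outputQuadratic hD hs.le hc hμ]
  field_simp
  ring

lemma PowerConstrained.integrable {P : ℝ} {μ : Measure (Fin D → ℝ)}
    (h : PowerConstrained P μ) : Integrable (fun b => b ⬝ᵥ b) μ := by
  refine ⟨?_, ?_⟩
  · exact Measurable.aestronglyMeasurable (by unfold dotProduct; fun_prop)
  · rw [hasFiniteIntegral_iff_ofReal (ae_of_all _ dotProduct_self_nonneg')]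
    exact h.2.trans_lt ENNReal.ofReal_lt_top

lemma PowerConstrained.integral_le {P : ℝ} (hP : 0 ≤ P) {μ : Measure (Fin D → ℝ)}
    (h : PowerConstrained P μ) : ∫ b, b ⬝ᵥ b ∂μ ≤ P := by
  rw [integral_eq_lintegral_of_nonneg_ae (ae_of_all _ dotProduct_self_nonneg')
    h.integrable.aestronglyMeasurable]
  exact ENNReal.toReal_le_of_le_ofReal hP h.2

lemma powerConstrained_isoGaussian (hD : 0 < D) {P : ℝ} (hP : 0 ≤ P) :
    PowerConstrained P (isoGaussian D (P / D)) := by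
  refine ⟨inferInstance, ?_⟩
  have hv : 0 ≤ P / D := by positivity
  rw [← ofReal_integral_eq_lintegral_ofReal (integrable_dotProduct_self_isoGaussian D _)
    (ae_of_all _ dotProduct_self_nonneg'), integral_dotProduct_self_isoGaussian D hv,
    mul_div_cancel₀ _ (by positivity)]

/-- Replacing the true output density by the Gaussian reference can only increase the integral, by
Gibbs' inequality; the resulting value exceeds the claimed bound by a nonpositive correction. -/
lemma inputInformation_le (hD : 0 < D) {P σ : ℝ} (hP : 0 < P) (hσ : 0 < σ)
    {μ : Measure (Fin D → ℝ)} (h : PowerConstrained P μ) :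
    inputInformation N D σ μ ≤ ENNReal.ofReal (1 / 2 *
      ∫ X : Matrix (Fin N) (Fin D) ℝ, Real.log (1 + (P / D / σ ^ 2) • (X * Xᵀ)).det
        ∂(gaussianMatrix N D)) := by
  have := h.1
  have hs : 0 < σ ^ 2 := by positivity
  have hv : 0 < P / D := by positivity
  have hc : 0 ≤ P / D / σ ^ 2 := by positivity
  have hq := measurable_outputDensity (N := N) (D := D) (σ ^ 2) (P / D / σ ^ 2)
  have hp := measurable_marginalDensity (N := N) (s := σ ^ 2) μ
  have hQ : outputLaw N D (σ ^ 2) (isoGaussian D (P / D)) = (volume.prod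
      (gaussianMatrix N D)).withDensity
      (fun z => ENNReal.ofReal (outputDensity (σ ^ 2) (P / D / σ ^ 2) z.2 z.1)) := by
    rw [outputLaw_eq_withDensity _ hs]
    simp_rw [marginalDensity_isoGaussian hs hv]
  have hqi := integrable_log_outputDensity (N := N) hs hc h.integrable
  obtain ⟨hpi, hle⟩ := integrable_log_and_integral_log_le hp hq (marginalDensity_pos μ hs)
    (fun z => outputDensity_pos hs hc z.2 z.1) (outputLaw_eq_withDensity μ hs) hQ
    (marginalDensity_le μ hs) ((integrable_outputLaw_iff hq.log).2 hqi)
  rw [integral_outputLaw _ hq.log, integral_outputLaw _ hp.log] at hle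
  rw [integrable_outputLaw_iff hp.log] at hpi
  have hfi := integrable_log_channelDensity (N := N) (D := D) (μ := μ) hs
  rw [inputInformation_eq_integral μ hσ (hfi.sub hpi)]
  refine ENNReal.ofReal_le_ofReal ?_
  have hval := integral_log_channelDensity_sub (N := N) hD hs hc h.integrable
  rw [integral_sub hfi hqi] at hval
  rw [integral_sub hfi hpi]
  have hneg : ((∫ b, b ⬝ᵥ b ∂μ) / D - σ ^ 2 * (P / D / σ ^ 2)) *
      (∫ X : Matrix (Fin N) (Fin D) ℝ, (gainMatrix (P / D / σ ^ 2) X).trace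
        ∂(gaussianMatrix N D)) / (2 * σ ^ 2) ≤ 0 := by
    refine div_nonpos_of_nonpos_of_nonneg (mul_nonpos_of_nonpos_of_nonneg ?_
      (integral_trace_gainMatrix_nonneg hc)) (by positivity)
    rw [mul_div_cancel₀ _ hs.ne', sub_nonpos]
    have := h.integral_le hP.le
    gcongr
  linarith

lemma inputInformation_isoGaussian (hD : 0 < D) {P σ : ℝ} (hP : 0 < P) (hσ : 0 < σ) :
    inputInformation N D σ (isoGaussian D (P / D)) = ENNReal.ofReal (1 / 2 *
      ∫ X : Matrix (Fin N) (Fin D) ℝ, Real.log (1 + (P / D / σ ^ 2) • (X * Xᵀ)).det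
        ∂(gaussianMatrix N D)) := by
  have hs : 0 < σ ^ 2 := by positivity
  have hv : 0 < P / D := by positivity
  have hc : 0 ≤ P / D / σ ^ 2 := by positivity
  have hμ := integrable_dotProduct_self_isoGaussian D (P / D)
  have hint := (integrable_log_channelDensity (N := N) (D := D) hs).sub
    (integrable_log_outputDensity (N := N) hs hc hμ)
  rw [inputInformation_eq_integral _ hσ]
  · simp_rw [marginalDensity_isoGaussian hs hv]
    -- The Gaussian input uses the full power, `D · (P / D)`, so the correction term is exactly
    -- zero.
    rw [integral_log_channelDensity_sub hD hs hc hμ, integral_dotProduct_self_isoGaussian D hv.le,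
      mul_div_cancel_left₀ _ (by positivity), mul_div_cancel₀ _ hs.ne']
    simp
  · simp_rw [marginalDensity_isoGaussian hs hv]
    exact hint

lemma channelCapacity_eq (hD : 0 < D) {P σ : ℝ} (hP : 0 < P) (hσ : 0 < σ) :
    channelCapacity N D P σ = ENNReal.ofReal (1 / 2 *
      ∫ X : Matrix (Fin N) (Fin D) ℝ, Real.log (1 + (P / D / σ ^ 2) • (X * Xᵀ)).det
        ∂(gaussianMatrix N D)) := by
  refine le_antisymm (iSup₂_le fun μ h => inputInformation_le hD hP hσ h) ?_
  rw [← inputInformation_isoGaussian hD hP hσ]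
  exact le_iSup₂_of_le _ (powerConstrained_isoGaussian hD hP.le) le_rfl

end Capacity

/-! ### The maximum entropy prior -/

section Entropy

variable {D : ℕ}

lemma differentialEntropy_eq_of_integrable {μ : Measure (Fin D → ℝ)} (hac : μ ≪ volume)
    (hint : Integrable (fun b => Real.log (μ.rnDeriv volume b).toReal) μ) :
    differentialEntropy μ
      = ((-∫ b, Real.log (μ.rnDeriv volume b).toReal ∂μ : ℝ) : EReal) := by
  have h1 : ∫⁻ b, ENNReal.ofReal (Real.log (μ.rnDeriv volume b).toReal) ∂μ ≠ ∞ :=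
    hint.lintegral_lt_top.ne
  have h2 : ∫⁻ b, ENNReal.ofReal (-Real.log (μ.rnDeriv volume b).toReal) ∂μ ≠ ∞ :=
    hint.neg.lintegral_lt_top.ne
  rw [differentialEntropy, if_pos hac, integral_eq_lintegral_pos_part_sub_lintegral_neg_part hint,
    neg_sub, EReal.coe_sub, EReal.coe_ennreal_toReal h1, EReal.coe_ennreal_toReal h2]

/-- Under a second moment bound, the entropy is `-∞` unless the log-density is integrable. -/
lemma differentialEntropy_eq_bot_or_integrable {μ : Measure (Fin D → ℝ)} [IsProbabilityMeasure μ]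
    (hμ : Integrable (fun b => b ⬝ᵥ b) μ) :
    differentialEntropy μ = ⊥ ∨
      (μ ≪ volume ∧ Integrable (fun b => Real.log (μ.rnDeriv volume b).toReal) μ) := by
  by_cases hac : μ ≪ volume
  swap
  · exact Or.inl (if_neg hac)
  by_cases hpos : ∫⁻ b, ENNReal.ofReal (Real.log (μ.rnDeriv volume b).toReal) ∂μ = ∞
  · left
    -- In `EReal` anything minus `⊤` is `⊥`, including `⊤ - ⊤`.
    rw [differentialEntropy, if_pos hac, hpos]
    simp
  refine Or.inr ⟨hac, ?_⟩
  set p : (Fin D → ℝ) → ℝ := fun b => (μ.rnDeriv volume b).toReal with hp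
  have hpm : Measurable p := by fun_prop
  have hp0 : ∀ᵐ b ∂μ, 0 < p b := by
    filter_upwards [Measure.rnDeriv_pos hac, hac.ae_le (Measure.rnDeriv_lt_top μ volume)]
      with b h1 h2
    exact ENNReal.toReal_pos h1.ne' h2.ne
  -- Only an inequality: where `p` vanishes the quotient is 0 by convention and the Gaussian mass
  -- there is lost. Variance 1 is arbitrary; any Gaussian with log-density integrable under `μ`
  -- would do.
  have hratio : ∫⁻ b, ENNReal.ofReal (gaussDensity D 1 b / p b) ∂μ ≤ 1 := by
    calc _ = ∫⁻ b, ENNReal.ofReal (gaussDensity D 1 b / p b)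
          ∂(volume.withDensity (μ.rnDeriv volume)) := by
          rw [Measure.withDensity_rnDeriv_eq _ _ hac]
      _ = ∫⁻ b, μ.rnDeriv volume b * ENNReal.ofReal (gaussDensity D 1 b / p b) :=
          lintegral_withDensity_eq_lintegral_mul _ (Measure.measurable_rnDeriv _ _) (by fun_prop)
      _ ≤ ∫⁻ b, ENNReal.ofReal (gaussDensity D 1 b) := by
          refine lintegral_mono_ae ?_
          filter_upwards [Measure.rnDeriv_lt_top μ volume] with b hb
          rw [← ENNReal.ofReal_toReal hb.ne, ← ENNReal.ofReal_mul ENNReal.toReal_nonneg]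
          refine ENNReal.ofReal_le_ofReal ?_
          change p b * _ ≤ _
          by_cases h0 : p b = 0
          · simpa [h0] using (gaussDensity_pos D one_pos b).le
          · rw [mul_div_cancel₀ _ h0]
      _ = 1 := lintegral_gaussDensity D one_pos
  have hgi : Integrable (fun b => Real.log (gaussDensity D 1 b)) μ := by
    simp_rw [log_gaussDensity D one_pos]
    exact (integrable_const _).sub (hμ.div_const _)
  have hri : Integrable (fun b => gaussDensity D 1 b / p b) μ := by
    refine ⟨Measurable.aestronglyMeasurable (by fun_prop), ?_⟩
    rw [hasFiniteIntegral_iff_ofReal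
      (ae_of_all _ fun b => div_nonneg (gaussDensity_pos D one_pos b).le ENNReal.toReal_nonneg)]
    exact hratio.trans_lt ENNReal.one_lt_top
  have hposi : Integrable (fun b => max (Real.log (p b)) 0) μ := by
    refine ⟨Measurable.aestronglyMeasurable (by fun_prop), ?_⟩
    rw [hasFiniteIntegral_iff_ofReal (ae_of_all _ fun b => le_max_right (Real.log (p b)) 0)]
    simpa [ENNReal.ofReal_max] using lt_top_iff_ne_top.2 hpos
  -- The lower bound is `log (g / p) ≤ g / p - 1`, with the harmless constant dropped; the upper
  -- bound is the positive part, integrable in this case.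
  refine integrable_of_le_of_le (Measurable.aestronglyMeasurable (by fun_prop))
    (g₁ := fun b => Real.log (gaussDensity D 1 b) - gaussDensity D 1 b / p b) ?_
    (ae_of_all _ fun b => le_max_left _ _) (hgi.sub hri) hposi
  filter_upwards [hp0] with b hb
  have hg := gaussDensity_pos D one_pos b
  have := Real.log_le_sub_one_of_pos (div_pos hg hb)
  rw [Real.log_div hg.ne' hb.ne'] at this
  linarith

lemma integral_log_gaussDensity {v : ℝ} (hv : 0 < v) {μ : Measure (Fin D → ℝ)}
    [IsProbabilityMeasure μ] (hμ : Integrable (fun b => b ⬝ᵥ b) μ) :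
    ∫ b, Real.log (gaussDensity D v b) ∂μ
      = -(D * Real.log (√(2 * Real.pi * v))) - (∫ b, b ⬝ᵥ b ∂μ) / (2 * v) := by
  simp_rw [log_gaussDensity D hv]
  rw [integral_sub (integrable_const _) (hμ.div_const _), integral_div]
  simp

lemma isoGaussian_absolutelyContinuous {v : ℝ} (hv : 0 < v) : isoGaussian D v ≪ volume := by
  rw [isoGaussian_eq_withDensity D hv]
  exact withDensity_absolutelyContinuous _ _

lemma differentialEntropy_isoGaussian {v : ℝ} (hv : 0 < v) :
    differentialEntropy (isoGaussian D v)
      = ((D * Real.log (√(2 * Real.pi * v)) + D / 2 : ℝ) : EReal) := by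
  have hac := isoGaussian_absolutelyContinuous (D := D) hv
  have hd : (isoGaussian D v).rnDeriv volume
      =ᵐ[volume] fun x => ENNReal.ofReal (gaussDensity D v x) := by
    rw [isoGaussian_eq_withDensity D hv]
    exact Measure.rnDeriv_withDensity _ (by fun_prop)
  have hlog : (fun b => Real.log (gaussDensity D v b)) =ᵐ[isoGaussian D v]
      fun b => Real.log ((isoGaussian D v).rnDeriv volume b).toReal := by
    filter_upwards [hac.ae_le hd] with b hb
    rw [hb, ENNReal.toReal_ofReal (gaussDensity_pos D hv b).le]
  have hμ := integrable_dotProduct_self_isoGaussian D v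
  have hgi : Integrable (fun b => Real.log (gaussDensity D v b)) (isoGaussian D v) := by
    simp_rw [log_gaussDensity D hv]
    exact (integrable_const _).sub (hμ.div_const _)
  rw [differentialEntropy_eq_of_integrable hac (hgi.congr hlog), ← integral_congr_ae hlog,
    integral_log_gaussDensity hv hμ, integral_dotProduct_self_isoGaussian D hv.le]
  congr 1
  field_simp
  ring

/-- The entropy of a law with a log-integrable density is at most the cross entropy with an
isotropic Gaussian, with equality only for that Gaussian. -/
lemma neg_integral_log_le_and_eq {v : ℝ} (hv : 0 < v) {μ : Measure (Fin D → ℝ)}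
    [IsProbabilityMeasure μ] (hμ : Integrable (fun b => b ⬝ᵥ b) μ) (hac : μ ≪ volume)
    (hint : Integrable (fun b => Real.log (μ.rnDeriv volume b).toReal) μ) :
    -∫ b, Real.log (μ.rnDeriv volume b).toReal ∂μ ≤ -∫ b, Real.log (gaussDensity D v b) ∂μ ∧
    (-∫ b, Real.log (μ.rnDeriv volume b).toReal ∂μ = -∫ b, Real.log (gaussDensity D v b) ∂μ →
      μ = isoGaussian D v) := by
  have hgi : Integrable (fun b => Real.log (gaussDensity D v b)) μ := by
    simp_rw [log_gaussDensity D hv]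
    exact (integrable_const _).sub (hμ.div_const _)
  -- The Gaussian density is positive everywhere, so Lebesgue measure is absolutely continuous with
  -- respect to the Gaussian law.
  have hac' : μ ≪ isoGaussian D v := by
    refine hac.trans ?_
    rw [isoGaussian_eq_withDensity D hv]
    refine withDensity_absolutelyContinuous' (by fun_prop) (ae_of_all _ fun b => ?_)
    simpa using gaussDensity_pos D hv b
  have hd : μ.rnDeriv (isoGaussian D v) =ᵐ[volume]
      fun x => (ENNReal.ofReal (gaussDensity D v x))⁻¹ * μ.rnDeriv volume x := by
    rw [isoGaussian_eq_withDensity D hv]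
    exact Measure.rnDeriv_withDensity_right μ volume (by fun_prop)
      (ae_of_all _ fun b => by simpa using gaussDensity_pos D hv b)
      (ae_of_all _ fun b => ENNReal.ofReal_ne_top)
  have hl : llr μ (isoGaussian D v) =ᵐ[μ] fun b =>
      Real.log (μ.rnDeriv volume b).toReal - Real.log (gaussDensity D v b) := by
    filter_upwards [hac.ae_le hd, Measure.rnDeriv_pos hac,
      hac.ae_le (Measure.rnDeriv_lt_top μ volume)] with b h1 h2 h3
    have hg := gaussDensity_pos D hv b
    rw [llr, h1, ENNReal.toReal_mul, ENNReal.toReal_inv, ENNReal.toReal_ofReal hg.le,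
      Real.log_mul (inv_pos.2 hg).ne' (ENNReal.toReal_pos h2.ne' h3.ne).ne', Real.log_inv]
    ring
  have hli : Integrable (llr μ (isoGaussian D v)) μ := (hint.sub hgi).congr hl.symm
  have hval : ∫ b, llr μ (isoGaussian D v) b ∂μ = ∫ b, Real.log (μ.rnDeriv volume b).toReal ∂μ
      - ∫ b, Real.log (gaussDensity D v b) ∂μ := by
    rw [integral_congr_ae hl, integral_sub hint hgi]
  have hnn := integral_llr_add_sub_measure_univ_nonneg hac' hli
  simp only [probReal_univ, add_sub_cancel_right, hval] at hnn
  refine ⟨by linarith, fun heq => ?_⟩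
  rw [← klDiv_eq_zero_iff, klDiv_of_ac_of_integrable hac' hli, hval]
  simp only [probReal_univ, add_sub_cancel_right, ENNReal.ofReal_eq_zero]
  linarith

/-- Entropy is at most cross entropy, which is at most the Gaussian entropy by the power constraint.
A maximizer makes both inequalities equalities, and the first equality already forces the Gaussian
law. -/
lemma isMaxEntropyPrior_iff (hD : 0 < D) {P : ℝ} (hP : 0 < P) (μ : Measure (Fin D → ℝ)) :
    IsMaxEntropyPrior P μ ↔ μ = isoGaussian D (P / D) := by
  have hv : 0 < P / D := by positivity
  have key (ν : Measure (Fin D → ℝ)) (hν : PowerConstrained P ν) :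
      differentialEntropy ν ≤ differentialEntropy (isoGaussian D (P / D)) ∧
      (differentialEntropy (isoGaussian D (P / D)) ≤ differentialEntropy ν →
        ν = isoGaussian D (P / D)) := by
    have := hν.1
    rw [differentialEntropy_isoGaussian hv]
    rcases differentialEntropy_eq_bot_or_integrable hν.integrable with h | ⟨hac, hint⟩
    · rw [h]
      exact ⟨bot_le, fun h' => absurd h' (EReal.bot_lt_coe _).not_ge⟩
    · obtain ⟨h1, h2⟩ := neg_integral_log_le_and_eq hv hν.integrable hac hint
      rw [differentialEntropy_eq_of_integrable hac hint, EReal.coe_le_coe_iff,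
        EReal.coe_le_coe_iff]
      have h3 : -∫ b, Real.log (gaussDensity D (P / D) b) ∂ν
          ≤ D * Real.log (√(2 * Real.pi * (P / D))) + D / 2 := by
        rw [integral_log_gaussDensity hv hν.integrable]
        have : (∫ b, b ⬝ᵥ b ∂ν) / (2 * (P / D)) ≤ D / 2 := by
          rw [div_le_iff₀ (by positivity)]
          refine (hν.integral_le hP.le).trans_eq ?_
          field_simp
        linarith
      exact ⟨h1.trans h3, fun h4 => h2 (le_antisymm h1 (h3.trans h4))⟩
  constructor
  · rintro ⟨h1, h2⟩
    exact (key μ h1).2 (h2 _ (powerConstrained_isoGaussian hD hP.le))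
  · rintro rfl
    exact ⟨powerConstrained_isoGaussian hD hP.le, fun ν hν => (key ν hν).1⟩

end Entropy

/-! ### Transfer to arbitrary random variables -/

lemma mutualInfo_eq_inputInformation {N D : ℕ} {σ : ℝ} {Ω : Type*} [MeasurableSpace Ω]
    {Pr : Measure Ω} [IsProbabilityMeasure Pr]
    {X : Ω → Matrix (Fin N) (Fin D) ℝ} {β : Ω → Fin D → ℝ} {ε : Ω → Fin N → ℝ}
    (hX : HasLaw X (gaussianMatrix N D) Pr) (hε : HasLaw ε (isoGaussian N (σ ^ 2)) Pr)
    (hβ : AEMeasurable β Pr) (hXε : IndepFun X ε Pr)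
    (hβXε : IndepFun β (fun ω => (X ω, ε ω)) Pr) :
    mutualInfo Pr β (fun ω => (linearOutput (X ω) (β ω) (ε ω), X ω))
      = inputInformation N D σ (Pr.map β) := by
  have h1 : Pr.map (fun ω => (X ω, ε ω)) = (gaussianMatrix N D).prod (isoGaussian N (σ ^ 2)) := by
    rw [(indepFun_iff_map_prod_eq_prod_map_map hX.aemeasurable hε.aemeasurable).1 hXε,
      hX.map_eq, hε.map_eq]
  have hm : AEMeasurable (fun ω => (β ω, (X ω, ε ω))) Pr :=
    hβ.prodMk (hX.aemeasurable.prodMk hε.aemeasurable)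
  have h2 : Pr.map (fun ω => (β ω, (X ω, ε ω))) = sourceLaw N D (σ ^ 2) (Pr.map β) := by
    rw [(indepFun_iff_map_prod_eq_prod_map_map hβ
      (hX.aemeasurable.prodMk hε.aemeasurable)).1 hβXε, h1]
  have hout : Measurable fun ω : (Fin D → ℝ) × (Matrix (Fin N) (Fin D) ℝ × (Fin N → ℝ)) =>
      (linearOutput ω.2.1 ω.1 ω.2.2, ω.2.1) := measurable_snd.comp (measurable_channelMap N D)
  -- By independence the product model carries the law of `(β, X, ε)`, so both informations are
  -- divergences between measures built from pushforwards of that one law.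
  change _ = mutualInfo (sourceLaw N D (σ ^ 2) (Pr.map β)) _ _
  rw [← h2]
  unfold mutualInfo
  have e1 := AEMeasurable.map_map_of_aemeasurable
    (measurable_channelMap N D).aemeasurable hm
  have e2 := AEMeasurable.map_map_of_aemeasurable measurable_fst.aemeasurable hm
  have e3 := AEMeasurable.map_map_of_aemeasurable hout.aemeasurable hm
  exact (congrArg₂ klDiv e1 (congrArg₂ Measure.prod e2 e3)).symm

theorem mainTheorem4 (N D : ℕ) (hD : 0 < D) (P σ : ℝ) (hP : 0 < P) (hσ : 0 < σ)
    {Ω : Type*} [MeasurableSpace Ω] (Pr : Measure Ω) [IsProbabilityMeasure Pr]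
    (X : Ω → Matrix (Fin N) (Fin D) ℝ) (β : Ω → Fin D → ℝ) (ε : Ω → Fin N → ℝ)
    (hX : HasLaw X (gaussianMatrix N D) Pr)
    (hε : HasLaw ε (isoGaussian N (σ ^ 2)) Pr)
    (hβ : AEMeasurable β Pr)
    (hβmax : IsMaxEntropyPrior P (Pr.map β))
    (hXε : IndepFun X ε Pr)
    (hβXε : IndepFun β (fun ω => (X ω, ε ω)) Pr) :
    (∀ μ : Measure (Fin D → ℝ), IsMaxEntropyPrior P μ ↔ μ = isoGaussian D (P / D)) ∧
    Integrable
      (fun ω => Real.log (1 + (P / σ ^ 2 / D) • (X ω * (X ω)ᵀ)).det) Pr ∧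
    channelCapacity N D P σ = ENNReal.ofReal
      (1 / 2 * ∫ ω, Real.log (1 + (P / σ ^ 2 / D) • (X ω * (X ω)ᵀ)).det ∂Pr) ∧
    mutualInfo Pr β (fun ω => (linearOutput (X ω) (β ω) (ε ω), X ω))
      = channelCapacity N D P σ := by
  have hm := (measurable_det_one_add (N := N) (D := D) (P / σ ^ 2 / D)).log
  refine ⟨isMaxEntropyPrior_iff hD hP, ?_, ?_, ?_⟩
  · have h := integrable_log_det (N := N) (D := D) (c := P / σ ^ 2 / D) (by positivity)
    rw [← hX.map_eq] at h
    exact h.comp_aemeasurable hX.aemeasurable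
  · have h := integral_map hX.aemeasurable hm.aestronglyMeasurable
    rw [hX.map_eq] at h
    rw [← h, channelCapacity_eq hD hP hσ, div_right_comm]
  · rw [mutualInfo_eq_inputInformation hX hε hβ hXε hβXε, (isMaxEntropyPrior_iff hD hP _).1 hβmax,
      inputInformation_isoGaussian hD hP hσ, channelCapacity_eq hD hP hσ]
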